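/- All graphs are finite, simple and undirected. Let $G=(V,E)$ be a graph. A function $f:V\to\{0,1,2\}$ is a \emph{Roman dominating function} (rdf) of $G$ if every $v\in V$ with $f(v)=0$ has a neighbor $u$ with $f(u)=2$. It is a \emph{minimal} rdf if there is no rdf $g\neq f$ with $g(v)\le f(v)$ for all $v\in V$. Theorem. There is a polynomial-space algorithm that, given a graph $G$ of order $n$, enumerates all minimal rdf of $G$, without repetition, with polynomial delay, and in total time $\mathcal{O}^*(1.9332^n)$. In particular, a graph of order $n$ has at most $\mathcal{O}^*(1.9332^n)$ minimal rdf. Here an algorithm is a single program of a random access machine (with addition and truncated subtraction on natural numbers, read-only access to $n$ and to the adjacency matrix of $G$, and a write-only output), for all graphs with vertex set $\{0,\dots,n-1\}$, $n\ge 0$; time is the number of its steps. Polynomial space means that there is a polynomial $q$ such that at any time the work memory (addresses and contents of the nonzero cells) takes at most $q(n)$ bits. Polynomial delay means that there is a polynomial $p$ such that at most $p(n)$ steps pass from the start to the first output, between any two consecutive outputs, and from the last output to the end of the computation. A quantity is $\mathcal{O}^*(1.9332^n)$ if it is at most $r(n)\cdot 1.9332^n$ for some polynomial $r$. -/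

import Mathlib

/-! # Roman dominating functions -/

/-- `f : V → {0, 1, 2}` is a Roman dominating function of `G`: every vertex of value `0` has a
neighbour of value `2`. -/
def IsRomanDominating {V : Type*} (G : SimpleGraph V) (f : V → Fin 3) : Prop :=
  ∀ v, f v = 0 → ∃ u, G.Adj v u ∧ f u = 2

/-- `f` is a minimal Roman dominating function: it is minimal among all Roman dominating functions
for the pointwise order on `V → {0, 1, 2}` that comes from `0 < 1 < 2`. -/
def IsMinimalRomanDominating {V : Type*} (G : SimpleGraph V) (f : V → Fin 3) : Prop :=
  Minimal (IsRomanDominating G) f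

/-! # A random access machine with a write-only output

A program works on a memory of cells, indexed by `ℕ`, that hold natural numbers and are all `0` at
the start. Its input is a graph with vertex set `{0, …, n - 1}`, given read-only by its order and
its adjacency matrix. Every command is one step. The only arithmetic is addition and truncated
subtraction. -/

namespace RAM

/-- Expressions, without side effects. Those of a given program have a fixed size, so evaluating
one takes a constant number of elementary machine operations. -/
inductive Expr : Type
  /-- a numerical constant -/
  | const (k : ℕ)
  /-- the order of the input graph -/
  | order
  /-- an entry of the adjacency matrix of the input graph -/
  | adj (a b : Expr)
  /-- the content of the memory cell whose address is the value of `a` -/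
  | load (a : Expr)
  /-- sum -/
  | add (a b : Expr)
  /-- truncated difference -/
  | sub (a b : Expr)

/-- Programs. -/
inductive Program : Type
  /-- write the value of `e` into the memory cell whose address is the value of `a` -/
  | store (a e : Expr)
  /-- append the value of `e` to the output word under construction -/
  | print (e : Expr)
  /-- output the word under construction and start a new, empty one -/
  | emit
  /-- first `c`, then `d` -/
  | seq (c d : Program)
  /-- `c` if the value of `e` is not `0`, else `d` -/
  | cond (e : Expr) (c d : Program)
  /-- repeat `c` as long as the value of `e` is not `0` -/
  | loop (e : Expr) (c : Program)

open Classical in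
/-- The entry `(a, b)` of the adjacency matrix of a graph on `{0, …, n - 1}`
(it is `0` outside of the matrix). -/
noncomputable def adjEntry {n : ℕ} (G : SimpleGraph (Fin n)) (a b : ℕ) : ℕ :=
  if ∃ (ha : a < n) (hb : b < n), G.Adj ⟨a, ha⟩ ⟨b, hb⟩ then 1 else 0

/-- The value of an expression on the input `G` when the memory is `M`. -/
noncomputable def Expr.eval {n : ℕ} (G : SimpleGraph (Fin n)) (M : ℕ →₀ ℕ) : Expr → ℕ
  | .const k => k
  | .order => n
  | .adj a b => adjEntry G (a.eval G M) (b.eval G M)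
  | .load a => M (a.eval G M)
  | .add a b => a.eval G M + b.eval G M
  | .sub a b => a.eval G M - b.eval G M

/-- A configuration: what remains to be executed (in this order), the memory, and the output word
under construction. -/
structure Config : Type where
  todo : List Program
  mem : ℕ →₀ ℕ
  word : List ℕ

/-- One step of the computation on the input `G`. A halted configuration does not change. -/
noncomputable def step {n : ℕ} (G : SimpleGraph (Fin n)) : Config → Config
  | ⟨[], M, w⟩ => ⟨[], M, w⟩
  | ⟨.store a e :: l, M, w⟩ => ⟨l, M.update (a.eval G M) (e.eval G M), w⟩
  | ⟨.print e :: l, M, w⟩ => ⟨l, M, w ++ [e.eval G M]⟩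
  | ⟨.emit :: l, M, _⟩ => ⟨l, M, []⟩
  | ⟨.seq c d :: l, M, w⟩ => ⟨c :: d :: l, M, w⟩
  | ⟨.cond e c d :: l, M, w⟩ => if e.eval G M ≠ 0 then ⟨c :: l, M, w⟩ else ⟨d :: l, M, w⟩
  | ⟨.loop e c :: l, M, w⟩ => if e.eval G M ≠ 0 then ⟨c :: .loop e c :: l, M, w⟩ else ⟨l, M, w⟩

/-- The word that is output by the step made from a configuration, if there is one. -/
def Config.emitted : Config → Option (List ℕ)
  | ⟨.emit :: _, _, w⟩ => some w
  | _ => none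

/-- Nothing remains to be executed. -/
def Config.Halted (c : Config) : Prop := c.todo = []

/-- The work space used by a configuration, in bits: for each memory cell that does not hold `0`,
the length of its address and of its content. (The input is read-only and the output write-only;
`todo` takes only finitely many values in the runs of a given program.) -/
noncomputable def Config.space (c : Config) : ℕ :=
  c.mem.sum fun a v => Nat.size a + Nat.size v

/-- The configuration that the program `P` reaches on the input `G` after `t` steps. -/
noncomputable def Program.run {n : ℕ} (P : Program) (G : SimpleGraph (Fin n)) (t : ℕ) : Config :=
  (step G)^[t] ⟨[P], 0, []⟩

/-- The words that `P` outputs on `G` during the first `T` steps, in the order of output, each with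
the number of steps made when it has been output. -/
noncomputable def Program.outputs {n : ℕ} (P : Program) (G : SimpleGraph (Fin n)) (T : ℕ) :
    List (ℕ × List ℕ) :=
  (List.range T).filterMap fun t => (P.run G t).emitted.map fun w => (t + 1, w)

end RAM

/-- The output word for a function on the vertices: its list of values. -/
def valueWord {n : ℕ} (f : Fin n → Fin 3) : List ℕ :=
  List.ofFn fun i => (f i : ℕ)

/-- If `P` halts on `G` within `T` steps, this says that it enumerates the minimal Roman dominating
functions of `G`, each exactly once. -/
def EnumeratesMinimalRDF {n : ℕ} (P : RAM.Program) (G : SimpleGraph (Fin n)) (T : ℕ) : Prop :=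
  ((P.outputs G T).map Prod.snd).Nodup ∧
    ∀ w : List ℕ, w ∈ (P.outputs G T).map Prod.snd ↔
      ∃ f : Fin n → Fin 3, IsMinimalRomanDominating G f ∧ w = valueWord f

/-- In a run of `P` on `G` that ends at time `T`, at most `d` steps pass before the first output,
between consecutive outputs, and from the last output to the end (from the start to the end if
there is no output). -/
def HasDelayAtMost {n : ℕ} (P : RAM.Program) (G : SimpleGraph (Fin n)) (T d : ℕ) : Prop :=
  (0 :: (P.outputs G T).map Prod.fst ++ [T]).IsChain fun s t => t ≤ s + d

/-! A minimal Roman dominating function is determined by the set `D` on which it is `2`: off `D` it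
is `0` at the vertices with a neighbour in `D` and `1` elsewhere. Minimality then says that no
vertex of `D` can be lowered to `1`, that is, each `v ∈ D` has a neighbour outside `D` whose only
neighbour in `D` is `v`. Hence minimal Roman dominating functions correspond bijectively to open
irredundant sets (`isMinimalRomanDominating_iff`, `rdfOf_injective`).

Enumeration: open irredundance is inherited by subsets. A backtracking search that keeps a new
vertex only if the set stays open irredundant has no dead ends, since every set kept is itself an
output. Between two outputs the position only decreases, and each move is a polynomial test
(`search_seg`). The total time is at most the delay times the number of outputs plus one.

Counting: the branching below bounds the number of outputs; it is not the algorithm that is run.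
With `I` selected and `U` undecided, the number of open irredundant sets between `I` and `I ∪ U` is
at most a product of vertex weights (`card_irredundantBetween_le`), by induction on the size of `U`.
A selected vertex needs a private neighbour among its candidates, so without candidates it is
discarded, and a candidate that is used forces its other neighbours out. In every case the factors
gained in the branches add up to at most `1`.

The weights are a = 1.9332 (undecided), b = 1.55184 (undecided and dominated) and c = 1.2888 = 2a/3
(discarded, still a possible private neighbour). The tight conditions are 2/3 + b²/a³ ≤ 1 and 2/(bc)
≤ 1. Equality in both gives a = 27^(1/5) ≈ 1.93318, which is rounded up. -/

/-! # Open irredundant sets -/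

/-- `D` is open irredundant: each of its vertices has a neighbour outside of `D` that has no other
neighbour in `D`. -/
def IsOpenIrredundant {V : Type*} (G : SimpleGraph V) (D : Finset V) : Prop :=
  ∀ v ∈ D, ∃ u ∉ D, G.Adj v u ∧ ∀ w ∈ D, G.Adj u w → w = v

/-! ### Weights, private candidates and the general branch estimate -/

section Counting

open Classical Finset

variable {V : Type*} (G : SimpleGraph V)

/-- `v` has a neighbour in `I`. -/
def HasNeighborIn (I : Finset V) (v : V) : Prop := ∃ i ∈ I, G.Adj v i

/-- The weight of a vertex when the vertices of `I` have been selected and those of `U` are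
undecided. -/
noncomputable def vertexWeight (I U : Finset V) (v : V) : ℝ :=
  if v ∈ I then 1
  else if v ∈ U then (if HasNeighborIn G I v then 1.55184 else 1.9332)
  else if HasNeighborIn G I v then 1
  else if HasNeighborIn G U v then 1.2888 else 1

variable {G} {I U I' U' : Finset V} {v u : V}

lemma HasNeighborIn.mono (h : I ⊆ I') (hv : HasNeighborIn G I v) : HasNeighborIn G I' v := by
  obtain ⟨i, hi, hvi⟩ := hv
  exact ⟨i, h hi, hvi⟩

lemma one_le_vertexWeight : 1 ≤ vertexWeight G I U v := by
  unfold vertexWeight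
  split_ifs <;> norm_num

/-- No weight grows along a branch, so a branch estimate only has to mention the vertices whose loss
it uses. -/
lemma vertexWeight_mono (hI : I ⊆ I') (hU : U' ⊆ U) :
    vertexWeight G I' U' v ≤ vertexWeight G I U v := by
  have h1 : HasNeighborIn G I v → HasNeighborIn G I' v := .mono hI
  have h2 : HasNeighborIn G U' v → HasNeighborIn G U v := .mono hU
  by_cases h3 : v ∈ I'
  · rw [show vertexWeight G I' U' v = 1 by simp [vertexWeight, h3]]
    exact one_le_vertexWeight
  have h4 : v ∉ I := fun h => h3 (hI h)
  unfold vertexWeight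
  rw [if_neg h3, if_neg h4]
  clear h3 h4 hI
  by_cases h5 : v ∈ U'
  · rw [if_pos h5, if_pos (hU h5)]
    split_ifs <;> first | (exact absurd (h1 ‹_›) ‹_›) | norm_num
  · rw [if_neg h5]
    split_ifs <;>
      first | (exact absurd (h1 ‹_›) ‹_›) | (exact absurd (h2 ‹_›) ‹_›) | norm_num

lemma vertexWeight_of_mem (h : v ∈ I) : vertexWeight G I U v = 1 := by
  simp [vertexWeight, h]

lemma vertexWeight_undominated (hI : v ∉ I) (hU : v ∈ U) (h : ¬ HasNeighborIn G I v) :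
    vertexWeight G I U v = 1.9332 := by
  simp [vertexWeight, *]

lemma vertexWeight_dominated (hI : v ∉ I) (hU : v ∈ U) (h : HasNeighborIn G I v) :
    vertexWeight G I U v = 1.55184 := by
  simp [vertexWeight, *]

lemma vertexWeight_discarded (hI : v ∉ I) (hU : v ∉ U) (h : ¬ HasNeighborIn G I v)
    (h' : HasNeighborIn G U v) : vertexWeight G I U v = 1.2888 := by
  simp [vertexWeight, *]

lemma vertexWeight_le_of_hasNeighborIn (h : HasNeighborIn G I v) :
    vertexWeight G I U v ≤ 1.55184 := by
  unfold vertexWeight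
  split_ifs <;> norm_num

lemma vertexWeight_le_of_notMem (h : v ∉ U) : vertexWeight G I U v ≤ 1.2888 := by
  unfold vertexWeight
  split_ifs <;> norm_num

lemma vertexWeight_eq_one_of_hasNeighborIn (hU : v ∉ U) (h : HasNeighborIn G I v) :
    vertexWeight G I U v = 1 := by
  simp [vertexWeight, *]

lemma vertexWeight_eq_one_of_forall_not_adj (hU : v ∉ U) (h : ∀ u ∈ U, ¬ G.Adj v u) :
    vertexWeight G I U v = 1 := by
  have : ¬ HasNeighborIn G U v := fun ⟨u, hu, hvu⟩ => h u hu hvu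
  simp [vertexWeight, *]

/-- Discarding an undecided vertex reduces its weight. -/
lemma vertexWeight_le_of_discarded (hI : v ∉ I) (hU : v ∈ U) (hII : I ⊆ I') (hv : v ∉ U') :
    vertexWeight G I' U' v ≤ (2 / 3) * vertexWeight G I U v := by
  -- An undominated vertex drops from 1.9332 to at most 1.2888, which is exactly two thirds; a
  -- dominated one drops to 1, and 1/1.55184 < 2/3.
  by_cases h : HasNeighborIn G I v
  · rw [vertexWeight_dominated hI hU h,
      vertexWeight_eq_one_of_hasNeighborIn hv (h.mono hII)]
    norm_num
  · rw [vertexWeight_undominated hI hU h]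
    have := vertexWeight_le_of_notMem (G := G) (I := I') hv
    norm_num at this ⊢
    linarith

variable (G) in
/-- The neighbours of `u` in `U`. -/
noncomputable def neighborsIn (U : Finset V) (u : V) : Finset V := U.filter fun v => G.Adj u v

lemma mem_neighborsIn : v ∈ neighborsIn G U u ↔ v ∈ U ∧ G.Adj u v := by
  simp [neighborsIn]

lemma card_le_of_cover_two {A B C : Finset (Finset V)} (h : ∀ D ∈ A, D ∈ B ∨ D ∈ C) :
    (A.card : ℝ) ≤ B.card + C.card := by
  have : A ⊆ B ∪ C := fun D hD => mem_union.2 (h D hD)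
  exact_mod_cast (card_le_card this).trans (card_union_le _ _)

lemma card_le_of_cover_three {A B C E : Finset (Finset V)}
    (h : ∀ D ∈ A, D ∈ B ∨ D ∈ C ∨ D ∈ E) : (A.card : ℝ) ≤ B.card + C.card + E.card := by
  have h1 := card_le_of_cover_two (A := A) (B := B) (C := C ∪ E) fun D hD => by
    rw [mem_union]; exact h D hD
  have h2 := card_le_of_cover_two (A := C ∪ E) (B := C) (C := E) fun D hD => mem_union.1 hD
  linarith

variable [Fintype V]

variable (G I U) in
/-- The product of the weights of the vertices. -/
noncomputable def totalWeight : ℝ := ∏ v, vertexWeight G I U v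

variable (G I U) in
/-- The open irredundant sets that contain `I` and are contained in `I ∪ U`. -/
noncomputable def irredundantBetween : Finset (Finset V) :=
  univ.filter fun D => IsOpenIrredundant G D ∧ I ⊆ D ∧ D ⊆ I ∪ U

variable (G I) in
/-- The neighbours of `v` that are neither in `I` nor adjacent to `I`. -/
noncomputable def privateCandidates (v : V) : Finset V :=
  univ.filter fun u => u ∉ I ∧ ¬ HasNeighborIn G I u ∧ G.Adj v u

lemma totalWeight_nonneg : 0 ≤ totalWeight G I U :=
  prod_nonneg fun _ _ => zero_le_one.trans one_le_vertexWeight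

/-- The factor of the head of the list is absorbed into `f` by an update at its vertex; distinctness
of the listed vertices keeps the other factors unaffected. -/
lemma prod_le_list_prod_mul_prod (f' : V → ℝ) (h0 : ∀ v, 0 ≤ f' v) (L : List (V × ℝ)) :
    ∀ f : V → ℝ, (L.map Prod.fst).Nodup → (∀ v, v ∉ L.map Prod.fst → f' v ≤ f v) →
      (∀ p ∈ L, f' p.1 ≤ p.2 * f p.1) → ∏ v, f' v ≤ (L.map Prod.snd).prod * ∏ v, f v := by
  induction L with
  | nil =>
    intro f _ h _
    simpa using prod_le_prod (fun v _ => h0 v) fun v _ => h v (by simp)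
  | cons p L ih =>
    intro f hL h hp
    rw [List.map_cons, List.nodup_cons] at hL
    have key := ih (Function.update f p.1 (p.2 * f p.1)) hL.2 (fun v hv => ?_) fun q hq => ?_
    · rw [prod_update_of_mem (mem_univ _)] at key
      have e : ∏ v, f v = f p.1 * ∏ v ∈ univ \ {p.1}, f v := by
        rw [sdiff_singleton_eq_erase, mul_prod_erase _ _ (mem_univ _)]
      rw [e, List.map_cons, List.prod_cons]
      linarith
    · by_cases hvp : v = p.1
      · subst hvp
        simpa using hp p (by simp)
      · rw [Function.update_of_ne hvp]
        exact h v (by simp only [List.map_cons, List.mem_cons, not_or]; exact ⟨hvp, hv⟩)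
    · have : q.1 ≠ p.1 := fun e => hL.1 (e ▸ List.mem_map_of_mem hq)
      rw [Function.update_of_ne this]
      exact hp q (List.mem_cons_of_mem _ hq)

/-- The number of sets between `I'` and `I' ∪ U'` is at most `r` times the weight of `(I, U)`. -/
def BranchBound (G : SimpleGraph V) (I U I' U' : Finset V) (r : ℝ) : Prop :=
  ((irredundantBetween G I' U').card : ℝ) ≤ r * totalWeight G I U

/-- Since `v` leaves the undecided set, the induction hypothesis applies to the branch; `L` lists
vertices with the factors by which their weights shrink. -/
lemma branchBound_of_list
    (ih : ∀ I' U' : Finset V, U'.card < U.card → Disjoint I' U' →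
      ((irredundantBetween G I' U').card : ℝ) ≤ totalWeight G I' U')
    (hd : Disjoint I' U') (hI : I ⊆ I') (hU : U' ⊆ U)
    (hv : v ∈ U) (hv' : v ∉ U') (L : List (V × ℝ)) (hL : (L.map Prod.fst).Nodup)
    (h : ∀ p ∈ L, vertexWeight G I' U' p.1 ≤ p.2 * vertexWeight G I U p.1) :
    BranchBound G I U I' U' (L.map Prod.snd).prod :=
  (ih I' U' (card_lt_card ⟨hU, fun h => hv' (h hv)⟩) hd).trans <|
    prod_le_list_prod_mul_prod _ (fun _ => zero_le_one.trans one_le_vertexWeight) L _ hL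
      (fun _ _ => vertexWeight_mono hI hU) h

lemma branchBound_out
    (ih : ∀ I' U' : Finset V, U'.card < U.card → Disjoint I' U' →
      ((irredundantBetween G I' U').card : ℝ) ≤ totalWeight G I' U')
    (hd : Disjoint I U) (X : Finset V) (hv : v ∈ U) (hvX : v ∈ X) (L : List (V × ℝ))
    (hL : (L.map Prod.fst).Nodup)
    (h : ∀ p ∈ L, vertexWeight G I (U \ X) p.1 ≤ p.2 * vertexWeight G I U p.1) :
    BranchBound G I U I (U \ X) (L.map Prod.snd).prod :=
  branchBound_of_list ih (hd.mono_right sdiff_subset) subset_rfl sdiff_subset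
    hv (by simp [hvX]) L hL h

/-- `X` contains `v` itself, which becomes selected, together with the vertices that this choice
forces out. -/
lemma branchBound_in
    (ih : ∀ I' U' : Finset V, U'.card < U.card → Disjoint I' U' →
      ((irredundantBetween G I' U').card : ℝ) ≤ totalWeight G I' U')
    (hd : Disjoint I U) (X : Finset V) (hv : v ∈ U) (hvX : v ∈ X) (L : List (V × ℝ))
    (hL : (L.map Prod.fst).Nodup)
    (h : ∀ p ∈ L, vertexWeight G (insert v I) (U \ X) p.1 ≤ p.2 * vertexWeight G I U p.1) :
    BranchBound G I U (insert v I) (U \ X) (L.map Prod.snd).prod := by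
  refine branchBound_of_list ih ?_ (subset_insert _ _) sdiff_subset hv (by simp [hvX]) L hL h
  · rw [disjoint_insert_left]
    exact ⟨by simp [hvX], hd.mono_right sdiff_subset⟩

variable {D : Finset V}

lemma mem_irredundantBetween :
    D ∈ irredundantBetween G I U ↔ IsOpenIrredundant G D ∧ I ⊆ D ∧ D ⊆ I ∪ U := by
  simp [irredundantBetween]

lemma mem_irredundantBetween_out (hD : D ∈ irredundantBetween G I U) (X : Finset V)
    (hX : ∀ x ∈ X, x ∉ D) : D ∈ irredundantBetween G I (U \ X) := by
  rw [mem_irredundantBetween] at hD ⊢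
  refine ⟨hD.1, hD.2.1, fun x hx => ?_⟩
  have := hD.2.2 hx
  have := hX x
  simp only [mem_union, mem_sdiff] at *
  tauto

lemma mem_irredundantBetween_in (hD : D ∈ irredundantBetween G I U) (X : Finset V) (hv : v ∈ D)
    (hX : ∀ x ∈ X, x ∈ D → x = v) : D ∈ irredundantBetween G (insert v I) (U \ X) := by
  rw [mem_irredundantBetween] at hD ⊢
  refine ⟨hD.1, insert_subset hv hD.2.1, fun x hx => ?_⟩
  have := hD.2.2 hx
  have := hX x
  simp only [mem_union, mem_sdiff, mem_insert] at *
  tauto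

/-- A private neighbour of `v` adjacent to some `i ∈ I ⊆ D` would give `i = v`, although `v` is
undecided. So only vertices not dominated by `I` can serve. -/
lemma exists_private (hd : Disjoint I U) (hD : D ∈ irredundantBetween G I U) (hvU : v ∈ U)
    (hv : v ∈ D) : ∃ u ∈ privateCandidates G I v, u ∉ D ∧ ∀ w ∈ D, G.Adj u w → w = v := by
  rw [mem_irredundantBetween] at hD
  obtain ⟨u, hu, hvu, h⟩ := hD.1 v hv
  refine ⟨u, ?_, hu, h⟩
  simp only [privateCandidates, mem_filter, mem_univ, true_and]
  refine ⟨fun hI => hu (hD.2.1 hI), fun ⟨i, hi, hui⟩ => ?_, hvu⟩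
  have := h i (hD.2.1 hi) hui
  exact disjoint_left.1 hd hi (this ▸ hvU)

lemma mem_privateCandidates :
    u ∈ privateCandidates G I v ↔ u ∉ I ∧ ¬ HasNeighborIn G I u ∧ G.Adj v u := by
  simp [privateCandidates]

/-- Selecting `v` reduces the weight of a private candidate. -/
lemma vertexWeight_le_of_mem_privateCandidates (hu : u ∈ privateCandidates G I v) (hv : v ∈ U)
    (hv' : v ∈ I') (hU : U' ⊆ U) :
    vertexWeight G I' U' u ≤ (1.55184 / 1.9332) * vertexWeight G I U u := by
  rw [mem_privateCandidates] at hu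
  have h1 : HasNeighborIn G I' u := ⟨v, hv', hu.2.2.symm⟩
  -- The stated factor is the loss of an undecided candidate; a discarded one loses more, as
  -- 1/1.2888 < 1.55184/1.9332.
  by_cases huU : u ∈ U
  · rw [vertexWeight_undominated hu.1 huU hu.2.1]
    have := vertexWeight_le_of_hasNeighborIn (U := U') h1
    norm_num at this ⊢
    exact this
  · rw [vertexWeight_discarded hu.1 huU hu.2.1 ⟨v, hv, hu.2.2.symm⟩,
      vertexWeight_eq_one_of_hasNeighborIn (fun h => huU (hU h)) h1]
    norm_num

end Counting

/-! ### The branching cases -/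

section Counting

open Classical Finset

variable {V : Type*} {G : SimpleGraph V} {I U I' U' : Finset V} {v u w x y : V}

lemma vertexWeight_le_in (hI : v ∉ I) (hU : v ∈ U) (h : ¬ HasNeighborIn G I v) (hv : v ∈ I') :
    vertexWeight G I' U' v ≤ (1 / 1.9332) * vertexWeight G I U v := by
  rw [vertexWeight_undominated hI hU h, vertexWeight_of_mem hv]
  norm_num

lemma vertexWeight_le_in_dominated (hI : v ∉ I) (hU : v ∈ U) (h : HasNeighborIn G I v)
    (hv : v ∈ I') : vertexWeight G I' U' v ≤ (1 / 1.55184) * vertexWeight G I U v := by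
  rw [vertexWeight_dominated hI hU h, vertexWeight_of_mem hv]
  norm_num

lemma vertexWeight_le_out_dominated (hI : v ∉ I) (hU : v ∈ U) (h : HasNeighborIn G I v)
    (hII : I ⊆ I') (hv : v ∉ U') :
    vertexWeight G I' U' v ≤ (1 / 1.55184) * vertexWeight G I U v := by
  rw [vertexWeight_dominated hI hU h, vertexWeight_eq_one_of_hasNeighborIn hv (h.mono hII)]
  norm_num

variable [Fintype V]

/-- A discarded candidate falls to weight 1 in two ways: it becomes dominated by `v`, or it loses
its last undecided neighbour and can no longer be private to anything. -/
lemma vertexWeight_le_candidate (hu : u ∈ privateCandidates G I v) (huU : u ∉ U) (hv : v ∈ U)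
    (hU : U' ⊆ U) (h : v ∈ I' ∨ ∀ x ∈ U', ¬ G.Adj u x) :
    vertexWeight G I' U' u ≤ (1 / 1.2888) * vertexWeight G I U u := by
  rw [mem_privateCandidates] at hu
  have huU' : u ∉ U' := fun h => huU (hU h)
  rw [vertexWeight_discarded hu.1 huU hu.2.1 ⟨v, hv, hu.2.2.symm⟩]
  have : vertexWeight G I' U' u = 1 := by
    rcases h with h | h
    · exact vertexWeight_eq_one_of_hasNeighborIn huU' ⟨v, h, hu.2.2.symm⟩
    · exact vertexWeight_eq_one_of_forall_not_adj huU' h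
  rw [this]
  norm_num

lemma vertexWeight_le_candidate_undecided (hu : u ∈ privateCandidates G I v) (huU : u ∈ U)
    (hU : u ∉ U') (h : v ∈ I') :
    vertexWeight G I' U' u ≤ (1 / 1.9332) * vertexWeight G I U u := by
  rw [mem_privateCandidates] at hu
  rw [vertexWeight_undominated hu.1 huU hu.2.1,
    vertexWeight_eq_one_of_hasNeighborIn hU ⟨v, h, hu.2.2.symm⟩]
  norm_num

lemma card_le_of_two_branches {I₁ U₁ I₂ U₂ : Finset V} {r₁ r₂ : ℝ}
    (h₁ : BranchBound G I U I₁ U₁ r₁) (h₂ : BranchBound G I U I₂ U₂ r₂) (hr : r₁ + r₂ ≤ 1)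
    (h : ∀ D ∈ irredundantBetween G I U,
      D ∈ irredundantBetween G I₁ U₁ ∨ D ∈ irredundantBetween G I₂ U₂) :
    ((irredundantBetween G I U).card : ℝ) ≤ totalWeight G I U := by
  have := card_le_of_cover_two h
  have := mul_le_mul_of_nonneg_right hr (totalWeight_nonneg (G := G) (I := I) (U := U))
  unfold BranchBound at h₁ h₂
  linarith

lemma card_le_of_three_branches {I₁ U₁ I₂ U₂ I₃ U₃ : Finset V} {r₁ r₂ r₃ : ℝ}
    (h₁ : BranchBound G I U I₁ U₁ r₁) (h₂ : BranchBound G I U I₂ U₂ r₂)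
    (h₃ : BranchBound G I U I₃ U₃ r₃) (hr : r₁ + r₂ + r₃ ≤ 1)
    (h : ∀ D ∈ irredundantBetween G I U, D ∈ irredundantBetween G I₁ U₁ ∨
      D ∈ irredundantBetween G I₂ U₂ ∨ D ∈ irredundantBetween G I₃ U₃) :
    ((irredundantBetween G I U).card : ℝ) ≤ totalWeight G I U := by
  have := card_le_of_cover_three h
  have := mul_le_mul_of_nonneg_right hr (totalWeight_nonneg (G := G) (I := I) (U := U))
  unfold BranchBound at h₁ h₂ h₃
  linarith

variable (ih : ∀ I' U' : Finset V, U'.card < U.card → Disjoint I' U' →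
      ((irredundantBetween G I' U').card : ℝ) ≤ totalWeight G I' U')
    (hd : Disjoint I U) (hv : v ∈ U)

include ih hd hv

/-- A vertex without private candidates. -/
lemma card_le_of_no_candidate (hP : privateCandidates G I v = ∅) :
    ((irredundantBetween G I U).card : ℝ) ≤ totalWeight G I U := by
  have h := branchBound_out ih hd {v} hv (mem_singleton_self v) [] (by simp) (by simp)
  refine le_trans ?_ (h.trans_eq (by simp))
  refine Nat.cast_le.2 (card_le_card fun D hD => mem_irredundantBetween_out hD {v} ?_)
  intro x hx hxD
  rw [mem_singleton] at hx
  subst hx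
  obtain ⟨u, hu, -⟩ := exists_private hd hD hv hxD
  simp [hP] at hu

/-- An undominated vertex with two private candidates. -/
lemma card_le_of_undominated_of_two_candidates (h : ¬ HasNeighborIn G I v)
    (hx : x ∈ privateCandidates G I v) (hy : y ∈ privateCandidates G I v) (hxy : x ≠ y) :
    ((irredundantBetween G I U).card : ℝ) ≤ totalWeight G I U := by
  have hvI : v ∉ I := disjoint_right.1 hd hv
  have hvx : v ≠ x := (mem_privateCandidates.1 hx).2.2.ne
  have hvy : v ≠ y := (mem_privateCandidates.1 hy).2.2.ne
  have b₁ := branchBound_out (G := G) ih hd {v} hv (mem_singleton_self v) [(v, 2 / 3)] (by simp)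
    (List.forall_mem_cons.2 ⟨vertexWeight_le_of_discarded hvI hv subset_rfl (by simp), by simp⟩)
  have b₂ := branchBound_in (G := G) ih hd {v} hv (mem_singleton_self v)
    [(v, 1 / 1.9332), (x, 1.55184 / 1.9332), (y, 1.55184 / 1.9332)]
    (by simp [hvx, hvy, hxy])
    (List.forall_mem_cons.2 ⟨vertexWeight_le_in hvI hv h (mem_insert_self _ _),
      List.forall_mem_cons.2 ⟨vertexWeight_le_of_mem_privateCandidates hx hv
        (mem_insert_self _ _) sdiff_subset,
      List.forall_mem_cons.2 ⟨vertexWeight_le_of_mem_privateCandidates hy hv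
        (mem_insert_self _ _) sdiff_subset, by simp⟩⟩⟩)
  -- One of the two tight cases: 2/3 + 1.55184²/1.9332³ ≤ 1.
  refine card_le_of_two_branches b₁ b₂ (by norm_num) fun D hD => ?_
  by_cases hvD : v ∈ D
  · exact .inr (mem_irredundantBetween_in hD {v} hvD (by simp))
  · exact .inl (mem_irredundantBetween_out hD {v} (by simpa using hvD))

-- If `v` is selected, its only candidate `u` must be its private neighbour, which forces out `u`
-- and all other undecided neighbours of `u`.
omit ih in
lemma mem_between_of_unique_candidate {D : Finset V} (hD : D ∈ irredundantBetween G I U)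
    (hvD : v ∈ D) (hu : privateCandidates G I v = {u}) :
    D ∈ irredundantBetween G (insert v I) (U \ (insert u (insert v (neighborsIn G U u)))) := by
  obtain ⟨u', hu', huD, h⟩ := exists_private hd hD hv hvD
  rw [hu, mem_singleton] at hu'
  subst hu'
  refine mem_irredundantBetween_in hD _ hvD fun x hx hxD => ?_
  rw [mem_insert, mem_insert, mem_neighborsIn] at hx
  rcases hx with rfl | rfl | hx
  · exact absurd hxD huD
  · rfl
  · exact h x hxD hx.2

omit ih in
lemma mem_between_or_of_unique_candidate (hu : privateCandidates G I v = {u}) (D : Finset V)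
    (hD : D ∈ irredundantBetween G I U) : D ∈ irredundantBetween G I (U \ {v}) ∨
    D ∈ irredundantBetween G (insert v I) (U \ (insert u (insert v (neighborsIn G U u)))) := by
  by_cases hvD : v ∈ D
  · exact .inr (mem_between_of_unique_candidate hd hv hD hvD hu)
  · exact .inl (mem_irredundantBetween_out hD {v} (by simpa using hvD))

omit [Fintype V] ih hd hv in
lemma forall_not_adj_of_neighborsIn_eq (hn : neighborsIn G U u = {v}) :
    ∀ x ∈ U \ {v}, ¬ G.Adj u x := by
  intro x hx hux
  rw [mem_sdiff, mem_singleton] at hx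
  have : x ∈ neighborsIn G U u := mem_neighborsIn.2 ⟨hx.1, hux⟩
  rw [hn, mem_singleton] at this
  exact hx.2 this

/-- An undominated vertex with one private candidate. -/
lemma card_le_of_undominated_of_unique_candidate (h : ¬ HasNeighborIn G I v)
    (hu : privateCandidates G I v = {u}) :
    ((irredundantBetween G I U).card : ℝ) ≤ totalWeight G I U := by
  have hvI : v ∉ I := disjoint_right.1 hd hv
  have hu' : u ∈ privateCandidates G I v := by simp [hu]
  have hvu : v ≠ u := (mem_privateCandidates.1 hu').2.2.ne
  have hwv : vertexWeight G I (U \ {v}) v ≤ (2 / 3) * vertexWeight G I U v :=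
    vertexWeight_le_of_discarded hvI hv subset_rfl (by simp)
  have hwv' := fun U' => vertexWeight_le_in (U' := U') hvI hv h (mem_insert_self v I)
  have b₁ := branchBound_out (G := G) ih hd {v} hv (mem_singleton_self v) [(v, 2 / 3)] (by simp)
    (List.forall_mem_cons.2 ⟨hwv, by simp⟩)
  have hX : v ∈ insert u (insert v (neighborsIn G U u)) := by simp
  by_cases huU : u ∈ U
  · have b₂ := branchBound_in ih hd _ hv hX [(v, 1 / 1.9332), (u, 1 / 1.9332)] (by simp [hvu])
      (List.forall_mem_cons.2 ⟨hwv' _, List.forall_mem_cons.2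
        ⟨vertexWeight_le_candidate_undecided hu' huU (by simp) (mem_insert_self _ _), by simp⟩⟩)
    exact card_le_of_two_branches b₁ b₂ (by norm_num)
      (mem_between_or_of_unique_candidate hd hv hu)
  -- If `v` is the only undecided neighbour of `u`, then `u` loses its weight in both branches.
  -- Otherwise selecting `v` also discards another neighbour `w` of `u`.
  by_cases hn : neighborsIn G U u = {v}
  · have b₁' := branchBound_out (G := G) ih hd {v} hv (mem_singleton_self v)
      [(v, 2 / 3), (u, 1 / 1.2888)] (by simp [hvu])
      (List.forall_mem_cons.2 ⟨hwv, List.forall_mem_cons.2 ⟨vertexWeight_le_candidate hu' huU hv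
        sdiff_subset (.inr (forall_not_adj_of_neighborsIn_eq hn)), by simp⟩⟩)
    have b₂ := branchBound_in ih hd _ hv hX [(v, 1 / 1.9332), (u, 1 / 1.2888)] (by simp [hvu])
      (List.forall_mem_cons.2 ⟨hwv' _, List.forall_mem_cons.2 ⟨vertexWeight_le_candidate hu' huU
        hv sdiff_subset (.inl (mem_insert_self _ _)), by simp⟩⟩)
    exact card_le_of_two_branches b₁' b₂ (by norm_num)
      (mem_between_or_of_unique_candidate hd hv hu)
  · obtain ⟨w, hw, hwv⟩ : ∃ w ∈ neighborsIn G U u, w ≠ v := by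
      by_contra! hc
      refine hn (Subset.antisymm (fun x hx => by simpa using hc x hx) ?_)
      simpa [mem_neighborsIn, hv] using (mem_privateCandidates.1 hu').2.2.symm
    have hw' := mem_neighborsIn.1 hw
    have b₂ := branchBound_in ih hd _ hv hX [(v, 1 / 1.9332), (u, 1 / 1.2888), (w, 2 / 3)]
      (by simp [hvu, hwv.symm, hw'.2.ne])
      (List.forall_mem_cons.2 ⟨hwv' _, List.forall_mem_cons.2 ⟨vertexWeight_le_candidate hu' huU
        hv sdiff_subset (.inl (mem_insert_self _ _)), List.forall_mem_cons.2
        ⟨vertexWeight_le_of_discarded (disjoint_right.1 hd hw'.1) hw'.1 (subset_insert _ _)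
          (by simp [hw]), by simp⟩⟩⟩)
    exact card_le_of_two_branches b₁ b₂ (by norm_num)
      (mem_between_or_of_unique_candidate hd hv hu)

variable (hdom : ∀ x ∈ U, HasNeighborIn G I x)

include hdom

-- Candidates are undominated while all undecided vertices are dominated, so from here on every
-- candidate is a discarded vertex of weight 1.2888.
omit ih hd hv in
lemma notMem_of_mem_privateCandidates (hu : u ∈ privateCandidates G I v) : u ∉ U :=
  fun h => (mem_privateCandidates.1 hu).2.1 (hdom u h)

/-- A dominated vertex with three private candidates. -/
lemma card_le_of_dominated_of_three_candidates {z : V}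
    (hx : x ∈ privateCandidates G I v) (hy : y ∈ privateCandidates G I v)
    (hz : z ∈ privateCandidates G I v) (hxy : x ≠ y) (hxz : x ≠ z) (hyz : y ≠ z) :
    ((irredundantBetween G I U).card : ℝ) ≤ totalWeight G I U := by
  have hvI : v ∉ I := disjoint_right.1 hd hv
  have hne : ∀ {u}, u ∈ privateCandidates G I v → v ≠ u :=
    fun hu => (mem_privateCandidates.1 hu).2.2.ne
  have hw : ∀ {u}, u ∈ privateCandidates G I v →
      vertexWeight G (insert v I) (U \ {v}) u ≤ (1 / 1.2888) * vertexWeight G I U u :=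
    fun hu => vertexWeight_le_candidate hu (notMem_of_mem_privateCandidates hdom hu) hv
      sdiff_subset (.inl (mem_insert_self _ _))
  have b₁ := branchBound_out (G := G) ih hd {v} hv (mem_singleton_self v) [(v, 1 / 1.55184)]
    (by simp) (List.forall_mem_cons.2
      ⟨vertexWeight_le_out_dominated hvI hv (hdom v hv) subset_rfl (by simp), by simp⟩)
  have b₂ := branchBound_in (G := G) ih hd {v} hv (mem_singleton_self v)
    [(v, 1 / 1.55184), (x, 1 / 1.2888), (y, 1 / 1.2888), (z, 1 / 1.2888)]
    (by simp [hne hx, hne hy, hne hz, hxy, hxz, hyz])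
    (List.forall_mem_cons.2
      ⟨vertexWeight_le_in_dominated hvI hv (hdom v hv) (mem_insert_self _ _),
      List.forall_mem_cons.2 ⟨hw hx, List.forall_mem_cons.2 ⟨hw hy,
      List.forall_mem_cons.2 ⟨hw hz, by simp⟩⟩⟩⟩)
  refine card_le_of_two_branches b₁ b₂ (by norm_num) fun D hD => ?_
  by_cases hvD : v ∈ D
  · exact .inr (mem_irredundantBetween_in hD {v} hvD (by simp))
  · exact .inl (mem_irredundantBetween_out hD {v} (by simpa using hvD))

/-- A dominated vertex with one private candidate. -/
lemma card_le_of_dominated_of_unique_candidate (hu : privateCandidates G I v = {u}) :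
    ((irredundantBetween G I U).card : ℝ) ≤ totalWeight G I U := by
  have hvI : v ∉ I := disjoint_right.1 hd hv
  have hu' : u ∈ privateCandidates G I v := by simp [hu]
  have hvu : v ≠ u := (mem_privateCandidates.1 hu').2.2.ne
  have huU := notMem_of_mem_privateCandidates hdom hu'
  have hwv : vertexWeight G I (U \ {v}) v ≤ (1 / 1.55184) * vertexWeight G I U v :=
    vertexWeight_le_out_dominated hvI hv (hdom v hv) subset_rfl (by simp)
  have hwv' := fun U' =>
    vertexWeight_le_in_dominated (U' := U') hvI hv (hdom v hv) (mem_insert_self v I)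
  have hX : v ∈ insert u (insert v (neighborsIn G U u)) := by simp
  by_cases hn : neighborsIn G U u = {v}
  · have b₁ := branchBound_out (G := G) ih hd {v} hv (mem_singleton_self v)
      [(v, 1 / 1.55184), (u, 1 / 1.2888)] (by simp [hvu])
      (List.forall_mem_cons.2 ⟨hwv, List.forall_mem_cons.2 ⟨vertexWeight_le_candidate hu' huU hv
        sdiff_subset (.inr (forall_not_adj_of_neighborsIn_eq hn)), by simp⟩⟩)
    have b₂ := branchBound_in ih hd _ hv hX [(v, 1 / 1.55184), (u, 1 / 1.2888)] (by simp [hvu])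
      (List.forall_mem_cons.2 ⟨hwv' _, List.forall_mem_cons.2 ⟨vertexWeight_le_candidate hu' huU
        hv sdiff_subset (.inl (mem_insert_self _ _)), by simp⟩⟩)
    -- The other tight case: 2 / (1.55184 · 1.2888) ≤ 1.
    exact card_le_of_two_branches b₁ b₂ (by norm_num)
      (mem_between_or_of_unique_candidate hd hv hu)
  · obtain ⟨w, hw, hwv''⟩ : ∃ w ∈ neighborsIn G U u, w ≠ v := by
      by_contra! hc
      refine hn (Subset.antisymm (fun x hx => by simpa using hc x hx) ?_)
      simpa [mem_neighborsIn, hv] using (mem_privateCandidates.1 hu').2.2.symm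
    have hw' := mem_neighborsIn.1 hw
    have b₁ := branchBound_out (G := G) ih hd {v} hv (mem_singleton_self v) [(v, 1 / 1.55184)]
      (by simp) (List.forall_mem_cons.2 ⟨hwv, by simp⟩)
    have b₂ := branchBound_in ih hd _ hv hX [(v, 1 / 1.55184), (u, 1 / 1.2888), (w, 2 / 3)]
      (by simp [hvu, hwv''.symm, hw'.2.ne])
      (List.forall_mem_cons.2 ⟨hwv' _, List.forall_mem_cons.2 ⟨vertexWeight_le_candidate hu' huU
        hv sdiff_subset (.inl (mem_insert_self _ _)), List.forall_mem_cons.2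
        ⟨vertexWeight_le_of_discarded (disjoint_right.1 hd hw'.1) hw'.1 (subset_insert _ _)
          (by simp [hw]), by simp⟩⟩⟩)
    exact card_le_of_two_branches b₁ b₂ (by norm_num)
      (mem_between_or_of_unique_candidate hd hv hu)

/-- A dominated vertex that is the last undecided neighbour of a private candidate, and that has
another private candidate. -/
lemma card_le_of_dominated_of_neighborsIn_eq_singleton (hx : x ∈ privateCandidates G I v)
    (hy : y ∈ privateCandidates G I v) (hxy : x ≠ y) (hn : neighborsIn G U x = {v}) :
    ((irredundantBetween G I U).card : ℝ) ≤ totalWeight G I U := by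
  have hvI : v ∉ I := disjoint_right.1 hd hv
  have hvx : v ≠ x := (mem_privateCandidates.1 hx).2.2.ne
  have hvy : v ≠ y := (mem_privateCandidates.1 hy).2.2.ne
  have hxU := notMem_of_mem_privateCandidates hdom hx
  have hyU := notMem_of_mem_privateCandidates hdom hy
  have b₁ := branchBound_out (G := G) ih hd {v} hv (mem_singleton_self v)
    [(v, 1 / 1.55184), (x, 1 / 1.2888)] (by simp [hvx])
    (List.forall_mem_cons.2
      ⟨vertexWeight_le_out_dominated hvI hv (hdom v hv) subset_rfl (by simp),
      List.forall_mem_cons.2 ⟨vertexWeight_le_candidate hx hxU hv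
        sdiff_subset (.inr (forall_not_adj_of_neighborsIn_eq hn)), by simp⟩⟩)
  have b₂ := branchBound_in (G := G) ih hd {v} hv (mem_singleton_self v)
    [(v, 1 / 1.55184), (x, 1 / 1.2888), (y, 1 / 1.2888)] (by simp [hvx, hvy, hxy])
    (List.forall_mem_cons.2
      ⟨vertexWeight_le_in_dominated hvI hv (hdom v hv) (mem_insert_self _ _),
      List.forall_mem_cons.2 ⟨vertexWeight_le_candidate hx hxU hv sdiff_subset
        (.inl (mem_insert_self _ _)),
      List.forall_mem_cons.2 ⟨vertexWeight_le_candidate hy hyU hv sdiff_subset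
        (.inl (mem_insert_self _ _)), by simp⟩⟩⟩)
  refine card_le_of_two_branches b₁ b₂ (by norm_num) fun D hD => ?_
  by_cases hvD : v ∈ D
  · exact .inr (mem_irredundantBetween_in hD {v} hvD (by simp))
  · exact .inl (mem_irredundantBetween_out hD {v} (by simpa using hvD))

/-- Two dominated vertices that are the last undecided neighbours of a private candidate, and that
have other private candidates. -/
lemma card_le_of_dominated_of_neighborsIn_eq_pair {z : V} (hw : w ∈ U)
    (hxv : x ∈ privateCandidates G I v) (hyv : y ∈ privateCandidates G I v) (hxy : x ≠ y)
    (hxw : x ∈ privateCandidates G I w) (hzw : z ∈ privateCandidates G I w) (hxz : x ≠ z)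
    (hvw : v ≠ w) (hn : neighborsIn G U x = {v, w}) :
    ((irredundantBetween G I U).card : ℝ) ≤ totalWeight G I U := by
  have hvI : v ∉ I := disjoint_right.1 hd hv
  have hwI : w ∉ I := disjoint_right.1 hd hw
  have hvx : v ≠ x := (mem_privateCandidates.1 hxv).2.2.ne
  have hvy : v ≠ y := (mem_privateCandidates.1 hyv).2.2.ne
  have hwx : w ≠ x := (mem_privateCandidates.1 hxw).2.2.ne
  have hwz : w ≠ z := (mem_privateCandidates.1 hzw).2.2.ne
  have hxU := notMem_of_mem_privateCandidates hdom hxv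
  have hyU := notMem_of_mem_privateCandidates hdom hyv
  have hzU := notMem_of_mem_privateCandidates hdom hzw
  have hvz : v ≠ z := fun e => hzU (e ▸ hv)
  -- The branches are: neither vertex, `v`, and `w` without `v`. In the first one `x` has no
  -- undecided neighbour left.
  have b₁ := branchBound_out (G := G) ih hd {v, w} hv (by simp)
    [(v, 1 / 1.55184), (w, 1 / 1.55184), (x, 1 / 1.2888)] (by simp [hvx, hvw, hwx])
    (List.forall_mem_cons.2
      ⟨vertexWeight_le_out_dominated hvI hv (hdom v hv) subset_rfl (by simp),
      List.forall_mem_cons.2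
      ⟨vertexWeight_le_out_dominated hwI hw (hdom w hw) subset_rfl (by simp),
      List.forall_mem_cons.2 ⟨vertexWeight_le_candidate hxv hxU hv
        sdiff_subset (.inr ?_), by simp⟩⟩⟩)
  · have b₂ := branchBound_in (G := G) ih hd {v} hv (mem_singleton_self v)
      [(v, 1 / 1.55184), (x, 1 / 1.2888), (y, 1 / 1.2888)] (by simp [hvx, hvy, hxy])
      (List.forall_mem_cons.2
        ⟨vertexWeight_le_in_dominated hvI hv (hdom v hv) (mem_insert_self _ _),
        List.forall_mem_cons.2 ⟨vertexWeight_le_candidate hxv hxU hv sdiff_subset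
          (.inl (mem_insert_self _ _)),
        List.forall_mem_cons.2 ⟨vertexWeight_le_candidate hyv hyU hv sdiff_subset
          (.inl (mem_insert_self _ _)), by simp⟩⟩⟩)
    have b₃ := branchBound_in (G := G) ih hd {v, w} hw (by simp)
      [(v, 1 / 1.55184), (w, 1 / 1.55184), (x, 1 / 1.2888), (z, 1 / 1.2888)]
      (by simp [hvx, hvw, hwx, hwz, hvz, hxz])
      (List.forall_mem_cons.2
        ⟨vertexWeight_le_out_dominated hvI hv (hdom v hv) (subset_insert _ _) (by simp),
        List.forall_mem_cons.2
        ⟨vertexWeight_le_in_dominated hwI hw (hdom w hw) (mem_insert_self _ _),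
        List.forall_mem_cons.2 ⟨vertexWeight_le_candidate hxw hxU hw sdiff_subset
          (.inl (mem_insert_self _ _)),
        List.forall_mem_cons.2 ⟨vertexWeight_le_candidate hzw hzU hw sdiff_subset
          (.inl (mem_insert_self _ _)), by simp⟩⟩⟩⟩)
    refine card_le_of_three_branches b₁ b₂ b₃ (by norm_num) fun D hD => ?_
    by_cases hvD : v ∈ D
    · exact .inr (.inl (mem_irredundantBetween_in hD {v} hvD (by simp)))
    by_cases hwD : w ∈ D
    · refine .inr (.inr (mem_irredundantBetween_in hD {v, w} hwD fun x hx hxD => ?_))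
      rw [mem_insert, mem_singleton] at hx
      rcases hx with rfl | rfl
      exacts [absurd hxD hvD, rfl]
    · refine .inl (mem_irredundantBetween_out hD {v, w} fun x hx => ?_)
      rw [mem_insert, mem_singleton] at hx
      rcases hx with rfl | rfl <;> assumption
  · intro t ht hxt
    rw [mem_sdiff] at ht
    exact ht.2 (hn ▸ mem_neighborsIn.2 ⟨ht.1, hxt⟩)

/-- The branch in which `x` is the private neighbour of `v`: the other undecided neighbours of `x`,
at least two, are discarded, and `y` becomes dominated. -/
lemma branchBound_private (hx : x ∈ privateCandidates G I v) (hy : y ∈ privateCandidates G I v)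
    (hxy : x ≠ y) (hn : 3 ≤ (neighborsIn G U x).card) :
    BranchBound G I U (insert v I) (U \ (neighborsIn G U x))
      (1 / 1.55184 * (1 / 1.2888 * (1 / 1.2888 * (1 / 1.55184 * (1 / 1.55184))))) := by
  have hvI : v ∉ I := disjoint_right.1 hd hv
  have hvx : v ≠ x := (mem_privateCandidates.1 hx).2.2.ne
  have hvy : v ≠ y := (mem_privateCandidates.1 hy).2.2.ne
  have hxU := notMem_of_mem_privateCandidates hdom hx
  have hyU := notMem_of_mem_privateCandidates hdom hy
  have hvn : v ∈ neighborsIn G U x := mem_neighborsIn.2 ⟨hv, (mem_privateCandidates.1 hx).2.2.symm⟩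
  have hc : 1 < ((neighborsIn G U x).erase v).card := by
    rw [card_erase_of_mem hvn]; omega
  obtain ⟨s, hs, t, ht, hst⟩ := one_lt_card.1 hc
  rw [mem_erase] at hs ht
  have hsU := (mem_neighborsIn.1 hs.2).1
  have htU := (mem_neighborsIn.1 ht.2).1
  have hne : ∀ {a b : V}, a ∈ U → b ∉ U → b ≠ a := fun ha hb e => hb (e ▸ ha)
  have := branchBound_in (G := G) ih hd (neighborsIn G U x) hv hvn
    [(v, 1 / 1.55184), (x, 1 / 1.2888), (y, 1 / 1.2888), (s, 1 / 1.55184), (t, 1 / 1.55184)]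
    (by simp [hvx, hvy, hxy, hs.1.symm, ht.1.symm, hst, hne hsU hxU, hne htU hxU, hne hsU hyU,
      hne htU hyU])
    (List.forall_mem_cons.2
      ⟨vertexWeight_le_in_dominated hvI hv (hdom v hv) (mem_insert_self _ _),
      List.forall_mem_cons.2 ⟨vertexWeight_le_candidate hx hxU hv sdiff_subset
        (.inl (mem_insert_self _ _)),
      List.forall_mem_cons.2 ⟨vertexWeight_le_candidate hy hyU hv sdiff_subset
        (.inl (mem_insert_self _ _)),
      List.forall_mem_cons.2 ⟨vertexWeight_le_out_dominated (disjoint_right.1 hd hsU) hsU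
        (hdom s hsU) (subset_insert _ _) (by simp [hs.2]),
      List.forall_mem_cons.2 ⟨vertexWeight_le_out_dominated (disjoint_right.1 hd htU) htU
        (hdom t htU) (subset_insert _ _) (by simp [ht.2]), by simp⟩⟩⟩⟩⟩)
  simpa using this

/-- A dominated vertex with two private candidates, both with three undecided neighbours. -/
lemma card_le_of_dominated_of_two_candidates (hP : privateCandidates G I v = {x, y})
    (hxy : x ≠ y) (hnx : 3 ≤ (neighborsIn G U x).card)
    (hny : 3 ≤ (neighborsIn G U y).card) :
    ((irredundantBetween G I U).card : ℝ) ≤ totalWeight G I U := by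
  have hx : x ∈ privateCandidates G I v := by simp [hP]
  have hy : y ∈ privateCandidates G I v := by simp [hP]
  have b₁ := branchBound_out (G := G) ih hd {v} hv (mem_singleton_self v) [(v, 1 / 1.55184)]
    (by simp) (List.forall_mem_cons.2 ⟨vertexWeight_le_out_dominated (disjoint_right.1 hd hv) hv
      (hdom v hv) subset_rfl (by simp), by simp⟩)
  -- Sets in which both `x` and `y` are private to `v` are counted twice, which is harmless for an
  -- upper bound.
  refine card_le_of_three_branches b₁ (branchBound_private ih hd hv hdom hx hy hxy hnx)
    (branchBound_private ih hd hv hdom hy hx hxy.symm hny) (by norm_num) fun D hD => ?_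
  by_cases hvD : v ∈ D
  · right
    obtain ⟨u, hu, -, h⟩ := exists_private hd hD hv hvD
    rw [hP, mem_insert, mem_singleton] at hu
    rcases hu with rfl | rfl
    · exact .inl (mem_irredundantBetween_in hD _ hvD
        fun z hz hzD => h z hzD (mem_neighborsIn.1 hz).2)
    · exact .inr (mem_irredundantBetween_in hD _ hvD
        fun z hz hzD => h z hzD (mem_neighborsIn.1 hz).2)
  · exact .inl (mem_irredundantBetween_out hD {v} (by simpa using hvD))

/-- The case in which all undecided vertices are dominated. -/
lemma card_le_of_all_dominated :
    ((irredundantBetween G I U).card : ℝ) ≤ totalWeight G I U := by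
  -- Each claim yields either structure or the bound itself. What survives is: every undecided
  -- vertex has exactly two candidates, and each candidate has at least three undecided neighbours.
  have two : ∀ {v}, v ∈ U → (∃ x y, x ≠ y ∧ privateCandidates G I v = {x, y}) ∨
      ((irredundantBetween G I U).card : ℝ) ≤ totalWeight G I U := by
    intro v hv
    rcases Nat.lt_or_ge 2 (privateCandidates G I v).card with h3 | h3
    · obtain ⟨x, y, z, hx, hy, hz, hxy, hxz, hyz⟩ := two_lt_card_iff.1 h3
      exact .inr (card_le_of_dominated_of_three_candidates ih hd hv hdom hx hy hz hxy hxz hyz)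
    interval_cases h : (privateCandidates G I v).card
    · exact .inr (card_le_of_no_candidate ih hd hv (card_eq_zero.1 h))
    · obtain ⟨u, hu⟩ := card_eq_one.1 h
      exact .inr (card_le_of_dominated_of_unique_candidate ih hd hv hdom hu)
    · obtain ⟨x, y, hxy⟩ := card_eq_two.1 h
      exact .inl ⟨x, y, hxy⟩
  have other : ∀ {v x}, v ∈ U → x ∈ privateCandidates G I v →
      (∃ y ∈ privateCandidates G I v, x ≠ y) ∨
      ((irredundantBetween G I U).card : ℝ) ≤ totalWeight G I U := by
    intro v x hv hx
    rcases two hv with ⟨a, b, hab, h⟩ | h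
    · left
      simp only [h, mem_insert, mem_singleton] at hx ⊢
      rcases hx with rfl | rfl
      exacts [⟨b, .inr rfl, hab⟩, ⟨a, .inl rfl, hab.symm⟩]
    · exact .inr h
  have three : ∀ {v x}, v ∈ U → x ∈ privateCandidates G I v →
      3 ≤ (neighborsIn G U x).card ∨
      ((irredundantBetween G I U).card : ℝ) ≤ totalWeight G I U := by
    intro v x hv hx
    obtain ⟨y, hy, hxy⟩ | h := other hv hx
    swap
    · exact .inr h
    have hvn : v ∈ neighborsIn G U x :=
      mem_neighborsIn.2 ⟨hv, (mem_privateCandidates.1 hx).2.2.symm⟩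
    rcases Nat.lt_or_ge 2 (neighborsIn G U x).card with h3 | h3
    · exact .inl h3
    right
    interval_cases h : (neighborsIn G U x).card
    · simp [card_eq_zero.1 h] at hvn
    · obtain ⟨u, hu⟩ := card_eq_one.1 h
      rw [hu, mem_singleton] at hvn
      exact card_le_of_dominated_of_neighborsIn_eq_singleton ih hd hv hdom hx hy hxy (hvn ▸ hu)
    · obtain ⟨w, hw, hwv⟩ := exists_mem_ne (s := neighborsIn G U x) (by omega) v
      have hpair : neighborsIn G U x = {v, w} := by
        refine (eq_of_subset_of_card_le ?_ ?_).symm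
        · simp [insert_subset_iff, hvn, hw]
        · rw [h, card_pair hwv.symm]
      rw [mem_neighborsIn] at hw
      have hxw : x ∈ privateCandidates G I w := by
        rw [mem_privateCandidates] at hx ⊢
        exact ⟨hx.1, hx.2.1, hw.2.symm⟩
      obtain ⟨z, hz, hxz⟩ | h' := other hw.1 hxw
      · exact card_le_of_dominated_of_neighborsIn_eq_pair ih hd hv hdom hw.1 hx hy hxy hxw hz hxz
          hwv.symm hpair
      · exact h'
  obtain ⟨x, y, hxy, hP⟩ | h := two hv
  swap
  · exact h
  obtain hnx | h := three hv (x := x) (by simp [hP])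
  swap
  · exact h
  obtain hny | h := three hv (x := y) (by simp [hP])
  swap
  · exact h
  exact card_le_of_dominated_of_two_candidates ih hd hv hdom hP hxy hnx hny

omit hdom hd hv ih

/-- The number of open irredundant sets between `I` and `I ∪ U` is at most the weight. -/
theorem card_irredundantBetween_le (hd : Disjoint I U) :
    ((irredundantBetween G I U).card : ℝ) ≤ totalWeight G I U := by
  induction hn : U.card using Nat.strong_induction_on generalizing I U with
  | _ n ihn =>
    subst hn
    have ih : ∀ I' U' : Finset V, U'.card < U.card → Disjoint I' U' →
      ((irredundantBetween G I' U').card : ℝ) ≤ totalWeight G I' U' :=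
      fun I' U' hlt hd' => ihn _ hlt hd' rfl
    rcases U.eq_empty_or_nonempty with rfl | ⟨v, hv⟩
    · have h1 : (irredundantBetween G I ∅).card ≤ 1 := by
        rw [card_le_one]
        intro A hA B hB
        rw [mem_irredundantBetween, union_empty] at hA hB
        rw [Subset.antisymm hA.2.2 hA.2.1, Subset.antisymm hB.2.2 hB.2.1]
      have h2 : 1 ≤ totalWeight G I ∅ := by
        refine le_trans (by simp) (prod_le_prod (s := univ) (f := fun _ => (1 : ℝ))
          (fun _ _ => zero_le_one) fun _ _ => one_le_vertexWeight)
      exact le_trans (by exact_mod_cast h1) h2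
    by_cases hA : ∃ a ∈ U, ¬ HasNeighborIn G I a
    · obtain ⟨a, ha, hna⟩ := hA
      rcases Nat.lt_or_ge 1 (privateCandidates G I a).card with h2 | h2
      · obtain ⟨x, hx, y, hy, hxy⟩ := one_lt_card.1 h2
        exact card_le_of_undominated_of_two_candidates ih hd ha hna hx hy hxy
      interval_cases h : (privateCandidates G I a).card
      · exact card_le_of_no_candidate ih hd ha (card_eq_zero.1 h)
      · obtain ⟨u, hu⟩ := card_eq_one.1 h
        exact card_le_of_undominated_of_unique_candidate ih hd ha hna hu
    · push Not at hA
      exact card_le_of_all_dominated ih hd hv hA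

variable (G) in
/-- A graph of order `n` has at most `1.9332 ^ n` open irredundant sets. -/
theorem card_isOpenIrredundant_le :
    ((univ.filter fun D : Finset V => IsOpenIrredundant G D).card : ℝ) ≤
      1.9332 ^ Fintype.card V := by
  have h := card_irredundantBetween_le (G := G) (disjoint_empty_left (univ : Finset V))
  have h1 : irredundantBetween G ∅ univ = univ.filter fun D => IsOpenIrredundant G D := by
    ext D
    simp [irredundantBetween]
  have h2 : totalWeight G ∅ univ = 1.9332 ^ Fintype.card V := by
    have : ∀ v, vertexWeight G ∅ univ v = 1.9332 := fun v =>
      vertexWeight_undominated (notMem_empty v) (mem_univ v) fun ⟨i, hi, _⟩ => notMem_empty i hi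
    simp [totalWeight, this]
  rwa [h1, h2] at h

end Counting

/-! # Reasoning about runs -/

namespace RAM

/-- Addresses of nonzero cells and contents of cells are at most `B`. -/
def MemBounded (B : ℕ) (M : ℕ →₀ ℕ) : Prop := (∀ a, M a ≤ B) ∧ ∀ a, B < a → M a = 0

lemma MemBounded.update {B : ℕ} {M : ℕ →₀ ℕ} (h : MemBounded B M) {a v : ℕ} (ha : a ≤ B)
    (hv : v ≤ B) : MemBounded B (M.update a v) := by
  constructor <;> intro x
  · rw [Finsupp.coe_update, Function.update_apply]
    split_ifs
    exacts [hv, h.1 x]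
  · intro hx
    rw [Finsupp.coe_update, Function.update_of_ne (by omega)]
    exact h.2 x hx

lemma MemBounded.space_le {B : ℕ} {c : Config} (h : MemBounded B c.mem) :
    c.space ≤ (B + 1) * (2 * (B + 1)) := by
  have hs : c.mem.support ⊆ Finset.range (B + 1) := by
    intro a ha
    rw [Finset.mem_range]
    by_contra hB
    exact Finsupp.mem_support_iff.1 ha (h.2 a (by omega))
  have hsize : ∀ m ≤ B, Nat.size m ≤ B + 1 := fun m hm =>
    Nat.size_le.2 (hm.trans_lt (B.lt_two_pow_self.trans (Nat.pow_lt_pow_right (by omega)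
      (by omega))))
  unfold Config.space Finsupp.sum
  calc ∑ a ∈ c.mem.support, (Nat.size a + Nat.size (c.mem a))
      ≤ ∑ a ∈ c.mem.support, (2 * (B + 1)) := Finset.sum_le_sum fun a ha => by
        have h1 := hsize a (by have := Finset.mem_range.1 (hs ha); omega)
        have h2 := hsize _ (h.1 a)
        omega
    _ = c.mem.support.card * (2 * (B + 1)) := by rw [Finset.sum_const, smul_eq_mul]
    _ ≤ _ := Nat.mul_le_mul_right _ (by simpa using Finset.card_le_card hs)

variable {n : ℕ} (G : SimpleGraph (Fin n))

/-- `Seg G B d c c' k k' os`: the computation leads from `c` to `c'` and outputs the words `os` on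
the way, all memories are bounded by `B`, and the number of steps since the last output, which is
`k` at the start and `k'` at the end, does not exceed `d`. -/
inductive Seg (B d : ℕ) : Config → Config → ℕ → ℕ → List (List ℕ) → Prop
  | refl {c : Config} {k : ℕ} : MemBounded B c.mem → k ≤ d → Seg B d c c k k []
  | silent {c c' : Config} {k k' : ℕ} {os : List (List ℕ)} : MemBounded B c.mem → k < d →
      c.emitted = none → Seg B d (step G c) c' (k + 1) k' os → Seg B d c c' k k' os
  | emit {c c' : Config} {k k' : ℕ} {os : List (List ℕ)} {w : List ℕ} : MemBounded B c.mem →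
      k < d → c.emitted = some w → Seg B d (step G c) c' 0 k' os → Seg B d c c' k k' (w :: os)

variable {G} {B d : ℕ}

lemma Seg.trans {c c' c'' : Config} {k k' k'' : ℕ} {os os' : List (List ℕ)}
    (h : Seg G B d c c' k k' os) (h' : Seg G B d c' c'' k' k'' os') :
    Seg G B d c c'' k k'' (os ++ os') := by
  induction h with
  | refl => exact h'
  | silent hM hk he _ ih => exact .silent hM hk he (ih h')
  | emit hM hk he _ ih => exact .emit hM hk he (ih h')

lemma Seg.next {c c₁ c' : Config} {k k' : ℕ} {os : List (List ℕ)} (hM : MemBounded B c.mem)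
    (hk : k < d) (he : c.emitted = none) (hc : step G c = c₁)
    (h : Seg G B d c₁ c' (k + 1) k' os) : Seg G B d c c' k k' os :=
  .silent hM hk he (hc ▸ h)

variable (G) in
/-- The outputs during the first `T` steps from a configuration. -/
noncomputable def outputsFrom (c : Config) (T : ℕ) : List (ℕ × List ℕ) :=
  (List.range T).filterMap fun t => ((step G)^[t] c).emitted.map fun w => (t + 1, w)

lemma outputsFrom_succ (c : Config) (T : ℕ) :
    outputsFrom G c (T + 1) = (c.emitted.map fun w => (1, w)).toList ++
      (outputsFrom G (step G c) T).map fun p => (p.1 + 1, p.2) := by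
  have h : (List.range T).filterMap ((fun t => ((step G)^[t] c).emitted.map fun w => (t + 1, w)) ∘
      Nat.succ) = (outputsFrom G (step G c) T).map fun p => (p.1 + 1, p.2) := by
    unfold outputsFrom
    rw [List.map_filterMap]
    congr 1
    funext t
    simp only [Function.comp_apply, Function.iterate_succ_apply, Option.map_map]
    rfl
  unfold outputsFrom at h ⊢
  rw [List.range_succ_eq_map, List.filterMap_cons, List.filterMap_map, h]
  cases hc : c.emitted <;> simp [hc]

/-- The induction moves the starting point, so the delay is stated for an arbitrary clock value `t₀`
at `c`; then `t₀ - k` is the time of the last output. -/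
lemma Seg.exists_time {c c' : Config} {k k' : ℕ} {os : List (List ℕ)}
    (h : Seg G B d c c' k k' os) : ∃ T, (step G)^[T] c = c' ∧
      (outputsFrom G c T).map Prod.snd = os ∧
      (∀ t ≤ T, MemBounded B ((step G)^[t] c).mem) ∧
      ∀ t₀, k ≤ t₀ → ((t₀ - k) :: (outputsFrom G c T).map (fun p => t₀ + p.1) ++ [t₀ + T]).IsChain
        fun s t => t ≤ s + d := by
  have hcomp : ∀ t₀ : ℕ, ((fun p : ℕ × List ℕ => t₀ + p.1) ∘ fun p : ℕ × List ℕ => (p.1 + 1, p.2)) =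
      fun p => t₀ + 1 + p.1 := fun t₀ => by
    funext p
    simp only [Function.comp_apply]
    omega
  induction h with
  | refl hM hk =>
    refine ⟨0, rfl, rfl, fun t ht => ?_, fun t₀ ht₀ => ?_⟩
    · obtain rfl : t = 0 := by omega
      exact hM
    · simp [outputsFrom]
      omega
  | silent hM hk he _ ih =>
    obtain ⟨T, h1, h2, h3, h4⟩ := ih
    refine ⟨T + 1, h1, ?_, fun t ht => ?_, fun t₀ ht₀ => ?_⟩
    · rw [outputsFrom_succ, he, ← h2]
      simp only [Option.map_none, Option.toList_none, List.nil_append, List.map_map]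
      rfl
    · cases t with
      | zero => exact hM
      | succ t => exact h3 t (by omega)
    · have := h4 (t₀ + 1) (by omega)
      rw [outputsFrom_succ, he]
      simp only [Option.map_none, Option.toList_none, List.nil_append, List.map_map]
      rw [hcomp, show t₀ + (T + 1) = t₀ + 1 + T by omega]
      rwa [show t₀ + 1 - (_ + 1) = t₀ - _ from Nat.add_sub_add_right _ _ _] at this
  | emit hM hk he _ ih =>
    obtain ⟨T, h1, h2, h3, h4⟩ := ih
    refine ⟨T + 1, h1, ?_, fun t ht => ?_, fun t₀ ht₀ => ?_⟩
    · rw [outputsFrom_succ, he, ← h2]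
      simp only [Option.map_some, Option.toList_some, List.nil_append, List.cons_append,
        List.map_cons, List.map_map]
      rfl
    · cases t with
      | zero => exact hM
      | succ t => exact h3 t (by omega)
    · have := h4 (t₀ + 1) (by omega)
      rw [outputsFrom_succ, he]
      simp only [Option.map_some, Option.toList_some, List.map_map, List.cons_append,
        List.nil_append, List.map_cons] at this ⊢
      refine List.isChain_cons_cons.2 ⟨by omega, ?_⟩
      rw [hcomp, show t₀ + (T + 1) = t₀ + 1 + T by omega]
      exact this

/-- There is one more gap than there are outputs; this turns the bound on the number of outputs into
a bound on the total time. -/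
lemma le_of_isChain_delay {l : List ℕ} {s T : ℕ}
    (h : (s :: l ++ [T]).IsChain fun s t => t ≤ s + d) : T ≤ s + (l.length + 1) * d := by
  induction l generalizing s with
  | nil => simpa using h
  | cons a l ih =>
    rw [List.cons_append, List.cons_append, List.isChain_cons_cons] at h
    have := ih h.2
    simp only [List.length_cons]
    nlinarith [h.1]

variable (G B d) in
/-- Started on the memory `M` and the word `w`, the program `P` ends after at most `t` steps,
without output, and with a memory and a word that satisfy `Q`. -/
def Runs (t : ℕ) (P : Program) (M : ℕ →₀ ℕ) (w : List ℕ) (Q : (ℕ →₀ ℕ) → List ℕ → Prop) : Prop :=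
  MemBounded B M → ∀ l k, k + t ≤ d → ∃ M' w' k', k' ≤ k + t ∧ MemBounded B M' ∧ Q M' w' ∧
    Seg G B d ⟨P :: l, M, w⟩ ⟨l, M', w'⟩ k k' []

variable {M : ℕ →₀ ℕ} {w : List ℕ} {Q Q' : (ℕ →₀ ℕ) → List ℕ → Prop} {t t₁ t₂ : ℕ}

lemma Runs.mono {P : Program} (h : Runs G B d t P M w Q) (hQ : ∀ M' w', Q M' w' → Q' M' w') :
    Runs G B d t P M w Q' := by
  intro hM l k hk
  obtain ⟨M', w', k', h1, h2, h3, h4⟩ := h hM l k hk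
  exact ⟨M', w', k', h1, h2, hQ _ _ h3, h4⟩

lemma Runs.store {a e : Expr} (ha : a.eval G M ≤ B) (he : e.eval G M ≤ B)
    (h : Q (M.update (a.eval G M) (e.eval G M)) w) : Runs G B d 1 (.store a e) M w Q :=
  fun hM _ k hk => ⟨_, w, k + 1, le_rfl, hM.update ha he, h,
    .silent hM (by omega) rfl (.refl (hM.update ha he) hk)⟩

lemma Runs.print {e : Expr} (h : Q M (w ++ [e.eval G M])) : Runs G B d 1 (.print e) M w Q :=
  fun hM _ k hk => ⟨M, _, k + 1, le_rfl, hM, h, .silent hM (by omega) rfl (.refl hM hk)⟩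

lemma Runs.seq {c e : Program}
    (h : Runs G B d t₁ c M w fun M' w' => Runs G B d t₂ e M' w' Q) :
    Runs G B d (t₁ + t₂ + 1) (.seq c e) M w Q := by
  intro hM l k hk
  obtain ⟨M₁, w₁, k₁, h1, h2, h3, h4⟩ := h hM (e :: l) (k + 1) (by omega)
  obtain ⟨M₂, w₂, k₂, h5, h6, h7, h8⟩ := h3 h2 l k₁ (by omega)
  exact ⟨M₂, w₂, k₂, by omega, h6, h7, .silent hM (by omega) rfl (h4.trans h8)⟩

/-- `Inv i` describes the state after `i` of the `m` rounds; each round costs one step for the test,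
and so does the exit. -/
lemma Runs.loop {e : Expr} {c : Program} {q : ℕ} (Inv : ℕ → (ℕ →₀ ℕ) → List ℕ → Prop) (m : ℕ)
    (hpos : ∀ i < m, ∀ M w, Inv i M w → e.eval G M ≠ 0)
    (hzero : ∀ M w, Inv m M w → e.eval G M = 0)
    (hc : ∀ i < m, ∀ M w, Inv i M w → Runs G B d q c M w (Inv (i + 1))) (h : Inv 0 M w) :
    Runs G B d (m * (q + 1) + 1) (.loop e c) M w (Inv m) := by
  have key : ∀ j i, i + j = m → ∀ M w, Inv i M w →
      Runs G B d (j * (q + 1) + 1) (.loop e c) M w (Inv m) := by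
    intro j
    induction j with
    | zero =>
      intro i hi M w h hM l k hk
      obtain rfl : i = m := by omega
      have hs : step G ⟨.loop e c :: l, M, w⟩ = ⟨l, M, w⟩ := by simp [step, hzero M w h]
      refine ⟨M, w, k + 1, by omega, hM, h, .silent hM (by omega) rfl ?_⟩
      rw [hs]
      exact .refl hM (by omega)
    | succ j ih =>
      intro i hi M w h hM l k hk
      rw [Nat.succ_mul] at hk ⊢
      have hs : step G ⟨.loop e c :: l, M, w⟩ = ⟨c :: .loop e c :: l, M, w⟩ := by
        simp [step, hpos i (by omega) M w h]
      obtain ⟨M₁, w₁, k₁, h1, h2, h3, h4⟩ :=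
        hc i (by omega) M w h hM (.loop e c :: l) (k + 1) (by omega)
      obtain ⟨M₂, w₂, k₂, h5, h6, h7, h8⟩ := ih (i + 1) (by omega) M₁ w₁ h3 h2 l k₁ (by omega)
      refine ⟨M₂, w₂, k₂, by omega, h6, h7, .silent hM (by omega) rfl ?_⟩
      rw [hs]
      exact h4.trans h8
  exact key m 0 (by omega) M w h

end RAM

/-! # The program

Cell `0` holds a position, cells `1`, `2`, `3` hold loop counters, cells `4`, `5`, `6` hold sums,
and cell `7 + i` tells whether the vertex `i` is selected. -/

namespace RAM

/-- The content of the cell with address `i`. -/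
def reg (i : ℕ) : Expr := .load (.const i)

/-- The content of the cell with address `7 + i`, where `i` is the content of the cell `r`. -/
def selected (r : ℕ) : Expr := .load (.add (.const 7) (reg r))

/-- The sum, in cell `a`, of the values of `e` after executing `body`, for the values of the cell
`c` from `0` to `n - 1`. -/
def sumLoop (c a : ℕ) (body : Program) (e : Expr) : Program :=
  .seq (.store (.const c) (.const 0)) <| .seq (.store (.const a) (.const 0)) <|
    .loop (.sub .order (reg c)) <| .seq body <| .seq (.store (.const a) (.add (reg a) e)) <|
      .store (.const c) (.add (reg c) (.const 1))

/-- The number of selected neighbours of the vertex in cell `r`. -/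
def countNeighbors (r : ℕ) : Program :=
  -- The body is a no-op. For values `0` and `1`, the difference `a - (1 - b)` is the conjunction of
  -- `a` and `b`.
  sumLoop 3 4 (.store (.const 3) (reg 3))
    (.sub (selected 3) (.sub (.const 1) (.adj (reg r) (reg 3))))

/-- The number of private neighbours of the vertex in cell `1`. -/
def countPrivate : Program :=
  sumLoop 2 5 (countNeighbors 2)
    -- `1 - (c - 1) - (1 - c)` is `1` exactly for `c = 1`, here for a unique selected neighbour.
    (.sub (.sub (.sub (.sub (.const 1) (.sub (reg 4) (.const 1))) (.sub (.const 1) (reg 4)))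
      (.sub (.const 1) (.adj (reg 1) (reg 2)))) (selected 2))

/-- The number of selected vertices without private neighbours. -/
def countBad : Program := sumLoop 1 6 countPrivate (.sub (selected 1) (reg 5))

/-- Build the word of the function given by the selected vertices. -/
def printWord : Program :=
  .seq (.store (.const 1) (.const 0)) <| .loop (.sub .order (reg 1)) <| .seq (countNeighbors 1) <|
    .seq (.print (.add (.add (selected 1) (selected 1))
      (.sub (.sub (.const 1) (reg 4)) (selected 1)))) <|
    .store (.const 1) (.add (reg 1) (.const 1))

/-- Store `k` for the vertex in cell `0`. -/
def select (k : ℕ) : Program := .store (.add (.const 7) (reg 0)) (.const k)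

/-- The selected set found is output, and the search continues behind its last vertex. -/
def report : Program := .seq printWord (.seq .emit (.store (.const 0) .order))

/-- One move of the search for the next set. -/
def searchStep : Program :=
  .seq (.store (.const 0) (.sub (reg 0) (.const 1))) <|
    -- A selected vertex met on the way down has had all its extensions explored, so it is removed.
    .cond (selected 0) (select 0) <| .seq (select 1) <| .seq countBad <|
      .cond (reg 6) (select 0) report

/-- The enumeration of the minimal Roman dominating functions. -/
def enumerate : Program := .seq report (.loop (reg 0) searchStep)

variable {n : ℕ} (G : SimpleGraph (Fin n))

/-- The number of selected neighbours of `u`. -/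
noncomputable def neighborCount (D : ℕ → ℕ) (u : ℕ) : ℕ :=
  ∑ w ∈ Finset.range n, (D w - (1 - adjEntry G u w))

/-- The number of private neighbours of `v`. -/
noncomputable def privateCount (D : ℕ → ℕ) (v : ℕ) : ℕ :=
  ∑ u ∈ Finset.range n, (1 - (neighborCount G D u - 1) - (1 - neighborCount G D u) -
    (1 - adjEntry G v u) - D u)

/-- The number of selected vertices without private neighbours. -/
noncomputable def badCount (D : ℕ → ℕ) : ℕ :=
  ∑ v ∈ Finset.range n, (D v - privateCount G D v)

/-- The value at `v` of the function given by the selected vertices. -/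
noncomputable def outputValue (D : ℕ → ℕ) (v : ℕ) : ℕ :=
  D v + D v + (1 - neighborCount G D v - D v)

variable {G} {B d : ℕ} {M : ℕ →₀ ℕ} {w : List ℕ} {Q : (ℕ →₀ ℕ) → List ℕ → Prop}

lemma Runs.of_eq {t t' : ℕ} {P : Program} (h : Runs G B d t P M w Q) (ht : t = t') :
    Runs G B d t' P M w Q := ht ▸ h

lemma eval_reg (i : ℕ) : (reg i).eval G M = M i := rfl

lemma eval_selected (r : ℕ) : (selected r).eval G M = M (7 + M r) := rfl

lemma update_apply_eq (M : ℕ →₀ ℕ) (a v x : ℕ) :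
    M.update a v x = if x = a then v else M x := by
  rw [Finsupp.coe_update, Function.update_apply]

/-- `T` collects the cells that the body may overwrite. Summands of size at most `1` keep the sum at
most `n`, hence within the memory bound. -/
lemma sumLoop_runs (hB : n + 7 ≤ B) {c a : ℕ} (hc : c < 7) (ha : a < 7) (hca : c ≠ a)
    (T : Finset ℕ) (haT : a ∉ T) (hcT : c ∉ T) {body : Program} {e : Expr} {tb : ℕ}
    (f : ℕ → ℕ) (hf : ∀ i < n, f i ≤ 1)
    (hbody : ∀ i < n, ∀ M', (∀ x, x ≠ a → x ≠ c → x ∉ T → M' x = M x) → M' c = i →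
      Runs G B d tb body M' w fun M'' w'' =>
        w'' = w ∧ (∀ x ∉ T, M'' x = M' x) ∧ e.eval G M'' = f i) :
    Runs G B d (n * (tb + 5) + 5) (sumLoop c a body e) M w fun M' w' =>
      w' = w ∧ M' a = ∑ i ∈ Finset.range n, f i ∧
        ∀ x, x ≠ a → x ≠ c → x ∉ T → M' x = M x := by
  have hsum : ∀ i ≤ n, ∑ j ∈ Finset.range i, f j ≤ i := fun i hi => by
    refine (Finset.sum_le_card_nsmul _ _ 1 fun j hj => hf j ?_).trans (by simp)
    have := Finset.mem_range.1 hj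
    omega
  have hloop : ∀ M₀ : ℕ →₀ ℕ, M₀ a = 0 → M₀ c = 0 →
      (∀ x, x ≠ a → x ≠ c → x ∉ T → M₀ x = M x) →
      Runs G B d (n * (tb + 4 + 1) + 1) (.loop (.sub .order (reg c)) <| .seq body <|
        .seq (.store (.const a) (.add (reg a) e)) <|
        .store (.const c) (.add (reg c) (.const 1))) M₀ w fun M' w' =>
      w' = w ∧ M' c = n ∧ M' a = ∑ i ∈ Finset.range n, f i ∧
        ∀ x, x ≠ a → x ≠ c → x ∉ T → M' x = M x := by
    intro M₀ h1 h2 h3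
    refine Runs.loop (fun i M' w' => w' = w ∧ M' c = i ∧ M' a = ∑ j ∈ Finset.range i, f j ∧
      ∀ x, x ≠ a → x ≠ c → x ∉ T → M' x = M x) n ?_ ?_ ?_ ⟨rfl, h2, by simpa using h1, h3⟩
    · rintro i hi M' w' ⟨-, h, -⟩
      simp only [Expr.eval, eval_reg, h]
      omega
    · rintro M' w' ⟨-, h, -⟩
      simp [Expr.eval, eval_reg, h]
    · rintro i hi M₁ _ ⟨rfl, h4, h5, h6⟩
      refine Runs.of_eq (Runs.seq ((hbody i hi M₁ h6 h4).mono ?_)) (by omega : tb + 3 + 1 = _)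
      rintro M₂ _ ⟨rfl, h7, h8⟩
      have e1 := h7 a haT
      have e2 := h7 c hcT
      have e3 := hsum (i + 1) hi
      rw [Finset.sum_range_succ] at e3
      refine Runs.seq (t₁ := 1) (t₂ := 1) (Runs.store (by simp [Expr.eval]; omega) ?_ ?_)
      · simp only [Expr.eval, eval_reg, h8, e1, h5]
        omega
      · refine Runs.store (by simp [Expr.eval]; omega) ?_ ⟨rfl, ?_, ?_, ?_⟩
        · simp only [Expr.eval, eval_reg, update_apply_eq, if_neg hca, e2, h4]
          omega
        · simp [Expr.eval, eval_reg, update_apply_eq, if_neg hca, e2, h4]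
        · simp only [Expr.eval, eval_reg, update_apply_eq, if_neg hca.symm, if_true, h8, e1, h5,
            Finset.sum_range_succ]
        · intro x hxa hxc hxT
          simp only [Expr.eval, update_apply_eq, if_neg hxa, if_neg hxc]
          rw [h7 x hxT, h6 x hxa hxc hxT]
  refine Runs.of_eq (Runs.seq (t₁ := 1) (Runs.store (by simp [Expr.eval]; omega)
    (by simp [Expr.eval]) (Runs.seq (t₁ := 1) (Runs.store (by simp [Expr.eval]; omega)
    (by simp [Expr.eval]) ((hloop _ ?_ ?_ ?_).mono ?_)))))
    (by ring : 1 + (1 + (n * (tb + 4 + 1) + 1) + 1) + 1 = _)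
  · simp [Expr.eval, update_apply_eq]
  · simp [Expr.eval, update_apply_eq]
  · intro x hxa hxc _
    simp [Expr.eval, update_apply_eq, hxa, hxc]
  · rintro M' w' ⟨h1, -, h2, h3⟩
    exact ⟨h1, h2, h3⟩

/-- The vertices marked in the memory. -/
def marks (M : ℕ →₀ ℕ) (i : ℕ) : ℕ := M (7 + i)

lemma countNeighbors_runs (hB : n + 7 ≤ B) {r : ℕ} (hr : r ≠ 3 ∧ r ≠ 4)
    (hM : ∀ i < n, marks M i ≤ 1) :
    Runs G B d (n * 6 + 5) (countNeighbors r) M w fun M' w' =>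
      w' = w ∧ M' 4 = neighborCount G (marks M) (M r) ∧ ∀ x, x ≠ 3 → x ≠ 4 → M' x = M x := by
  refine (sumLoop_runs (tb := 1) (M := M) (w := w) hB (by omega) (by omega) (by omega) ∅ (by simp)
    (by simp)
    (fun i => marks M i - (1 - adjEntry G (M r) i)) (fun i hi => by have := hM i hi; omega)
    ?_).mono ?_
  · intro i hi M' h1 h2
    have e : M'.update 3 i = M' := by
      ext x
      rw [update_apply_eq]
      split_ifs with h
      · rw [h, h2]
      · rfl
    refine Runs.store (by simp [Expr.eval]; omega) (by simp only [eval_reg, h2]; omega)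
      ⟨rfl, ?_, ?_⟩
    · intro x _
      simp only [Expr.eval, eval_reg, h2, e]
    · simp only [Expr.eval, eval_reg, eval_selected, e, h2]
      rw [h1 (7 + i) (by omega) (by omega) (by simp), h1 r hr.2 hr.1 (by simp)]
      rfl
  · rintro M' w' ⟨h1, h2, h3⟩
    exact ⟨h1, h2, fun x h4 h5 => h3 x h5 h4 (by simp)⟩

lemma countPrivate_runs (hB : n + 7 ≤ B) (hM : ∀ i < n, marks M i ≤ 1) :
    Runs G B d (n * (n * 6 + 5 + 5) + 5) countPrivate M w fun M' w' =>
      w' = w ∧ M' 5 = privateCount G (marks M) (M 1) ∧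
        ∀ x, x ∉ ({2, 3, 4, 5} : Finset ℕ) → M' x = M x := by
  refine (sumLoop_runs (tb := n * 6 + 5) (M := M) (w := w) hB (by omega) (by omega) (by omega)
    {3, 4} (by simp) (by simp) (fun u => 1 - (neighborCount G (marks M) u - 1) -
      (1 - neighborCount G (marks M) u) - (1 - adjEntry G (M 1) u) - marks M u)
    (fun i _ => by omega) ?_).mono ?_
  · intro i hi M' h1 h2
    have hm : marks M' = marks M := by
      funext j
      exact h1 _ (by omega) (by omega) (by simp; omega)
    refine (countNeighbors_runs hB (by omega) (hm ▸ hM)).mono ?_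
    rintro M'' _ ⟨rfl, h4, h5⟩
    refine ⟨rfl, fun x hx => ?_, ?_⟩
    · simp only [Finset.mem_insert, Finset.mem_singleton, not_or] at hx
      exact h5 x hx.1 hx.2
    · have e1 : M'' 2 = i := by rw [h5 2 (by omega) (by omega), h2]
      have e2 : M'' 1 = M 1 := by
        rw [h5 1 (by omega) (by omega), h1 1 (by omega) (by omega) (by simp)]
      have e3 : M'' (7 + i) = marks M i := by
        rw [h5 _ (by omega) (by omega), ← hm]
        rfl
      simp only [Expr.eval, eval_reg, eval_selected, e1, e2, e3, h4, h2, hm]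
  · rintro M' w' ⟨h1, h2, h3⟩
    refine ⟨h1, h2, fun x hx => ?_⟩
    simp only [Finset.mem_insert, Finset.mem_singleton, not_or] at hx
    exact h3 x hx.2.2.2 hx.1 (by simp [hx])

lemma countBad_runs (hB : n + 7 ≤ B) (hM : ∀ i < n, marks M i ≤ 1) :
    Runs G B d (n * (n * (n * 6 + 5 + 5) + 5 + 5) + 5) countBad M w fun M' w' =>
      w' = w ∧ M' 6 = badCount G (marks M) ∧ M' 0 = M 0 ∧ marks M' = marks M := by
  refine (sumLoop_runs (tb := n * (n * 6 + 5 + 5) + 5) (M := M) (w := w) hB (by omega) (by omega)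
    (by omega) {2, 3, 4, 5} (by simp) (by simp)
    (fun v => marks M v - privateCount G (marks M) v)
    (fun i hi => by have := hM i hi; omega) ?_).mono ?_
  · intro i hi M' h1 h2
    have hm : marks M' = marks M := by
      funext j
      exact h1 _ (by omega) (by omega) (by simp; omega)
    refine (countPrivate_runs hB (hm ▸ hM)).mono ?_
    rintro M'' _ ⟨rfl, h4, h5⟩
    refine ⟨rfl, h5, ?_⟩
    have e1 : M'' 1 = i := by rw [h5 1 (by simp), h2]
    have e3 : M'' (7 + i) = marks M i := by
      rw [h5 _ (by simp; omega), ← hm]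
      rfl
    simp only [Expr.eval, eval_reg, eval_selected, e1, e3, h4, h2, hm]
  · rintro M' w' ⟨h1, h2, h3⟩
    refine ⟨h1, h2, h3 0 (by omega) (by omega) (by simp), ?_⟩
    funext j
    exact h3 _ (by omega) (by omega) (by simp; omega)

lemma printWord_runs (hB : n + 7 ≤ B) (hM : ∀ i < n, marks M i ≤ 1) :
    Runs G B d (n * (n * 6 + 5 + 4 + 1) + 3) printWord M [] fun M' w' =>
      w' = (List.range n).map (outputValue G (marks M)) ∧ M' 0 = M 0 ∧ marks M' = marks M := by
  refine Runs.of_eq (Runs.seq (t₁ := 1) (Runs.store (by simp [Expr.eval]; omega)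
    (by simp [Expr.eval]) ((Runs.loop (q := n * 6 + 5 + 4) (fun i M' w' =>
      w' = (List.range i).map (outputValue G (marks M)) ∧ M' 1 = i ∧ M' 0 = M 0 ∧
      marks M' = marks M) n ?_ ?_ ?_ ⟨rfl, ?_, ?_, ?_⟩).mono ?_)))
    (by omega : 1 + (n * (n * 6 + 5 + 4 + 1) + 1) + 1 = _)
  · rintro i hi M' w' ⟨-, h, -⟩
    simp only [Expr.eval, eval_reg, h]
    omega
  · rintro M' w' ⟨-, h, -⟩
    simp [Expr.eval, eval_reg, h]
  · rintro i hi M' w' ⟨h1, h2, h3, hm⟩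
    refine Runs.of_eq (Runs.seq (t₁ := n * 6 + 5) (t₂ := 3)
      ((countNeighbors_runs hB (by omega) (hm ▸ hM)).mono ?_)) (by omega)
    rintro M'' w' ⟨rfl, h4, h5⟩
    have e1 : M'' 1 = i := by rw [h5 1 (by omega) (by omega), h2]
    have e3 : M'' (7 + i) = marks M i := by
      rw [h5 _ (by omega) (by omega), ← hm]
      rfl
    refine Runs.seq (t₁ := 1) (t₂ := 1) (Runs.print (Runs.store (by simp [Expr.eval]; omega)
      (by simp only [Expr.eval, eval_reg, e1]; omega) ⟨?_, ?_, ?_, ?_⟩))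
    · simp only [Expr.eval, eval_reg, eval_selected, e1, e3, h4, h2, hm, h1, List.range_succ,
        List.map_append, List.map_cons, List.map_nil]
      rfl
    · simp [Expr.eval, eval_reg, update_apply_eq, e1]
    · simp only [Expr.eval, update_apply_eq]
      rw [if_neg (by omega), h5 0 (by omega) (by omega), h3]
    · rw [← hm]
      funext j
      simp only [marks, Expr.eval, update_apply_eq]
      rw [if_neg (by omega), h5 _ (by omega) (by omega)]
  · simp [Expr.eval, update_apply_eq]
  · simp [Expr.eval, update_apply_eq]
  · funext j
    simp only [marks, Expr.eval, update_apply_eq]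
    rw [if_neg (by omega)]
  · rintro M' w' ⟨h1, -, h2⟩
    exact ⟨h1, h2⟩

end RAM

/-! ### Minimal Roman dominating functions and open irredundant sets -/

section MinimalRDF

open Classical Finset

variable {V : Type*} {G : SimpleGraph V}

/-- Private neighbours stay private when the set shrinks. This heredity is what makes pruning in the
search correct. -/
lemma IsOpenIrredundant.subset {D D' : Finset V} (h : IsOpenIrredundant G D) (hD : D' ⊆ D) :
    IsOpenIrredundant G D' := by
  intro v hv
  obtain ⟨u, hu, hvu, hw⟩ := h v (hD hv)
  exact ⟨u, fun h => hu (hD h), hvu, fun w hwD => hw w (hD hwD)⟩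

variable (G) in
/-- The least Roman dominating function with value `2` exactly on `D`. -/
noncomputable def rdfOf (D : Finset V) (v : V) : Fin 3 :=
  if v ∈ D then 2 else if HasNeighborIn G D v then 0 else 1

lemma rdfOf_eq_two {D : Finset V} {v : V} : rdfOf G D v = 2 ↔ v ∈ D := by
  unfold rdfOf
  split_ifs with h1 h2 <;> simp [h1]

lemma rdfOf_injective : Function.Injective (rdfOf G) := by
  intro D D' h
  ext v
  rw [← rdfOf_eq_two (G := G), h, rdfOf_eq_two]

/-- A smaller Roman dominating function `g` still vanishes at the private neighbour of `v ∈ D`,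
which only `v` can dominate, so `g v = 2`. A vertex of value `1` has no neighbour in `D`, so it
cannot be lowered to `0`. -/
lemma IsOpenIrredundant.isMinimalRomanDominating {D : Finset V} (h : IsOpenIrredundant G D) :
    IsMinimalRomanDominating G (rdfOf G D) := by
  refine ⟨fun v hv => ?_, fun g hg hgf v => ?_⟩
  · have h1 : v ∉ D := fun h => by
      rw [rdfOf_eq_two.2 h] at hv
      exact absurd hv (by decide)
    have h2 : HasNeighborIn G D v := by
      by_contra h2
      rw [rdfOf, if_neg h1, if_neg h2] at hv
      exact absurd hv (by decide)
    obtain ⟨u, hu, hvu⟩ := h2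
    exact ⟨u, hvu, rdfOf_eq_two.2 hu⟩
  · have two : ∀ u, g u = 2 → u ∈ D := fun u hu => by
      have := hgf u
      rw [hu] at this
      exact rdfOf_eq_two.1 (le_antisymm (Fin.le_last _) this)
    by_cases hv : v ∈ D
    · obtain ⟨u, hu, hvu, hw⟩ := h v hv
      have hu0 : rdfOf G D u = 0 := by
        unfold rdfOf
        rw [if_neg hu, if_pos ⟨v, hv, hvu.symm⟩]
      have hgu : g u = 0 := le_antisymm (hu0 ▸ hgf u) (Fin.zero_le _)
      obtain ⟨w, huw, hgw⟩ := hg u hgu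
      rw [← hw w (two w hgw) huw, hgw]
      exact Fin.le_last _
    · by_cases hn : HasNeighborIn G D v
      · rw [show rdfOf G D v = 0 by rw [rdfOf, if_neg hv, if_pos hn]]
        exact Fin.zero_le _
      · rw [show rdfOf G D v = 1 by rw [rdfOf, if_neg hv, if_neg hn]]
        have : g v ≠ 0 := fun h0 => by
          obtain ⟨u, hvu, hu⟩ := hg v h0
          exact hn ⟨u, two u hu, hvu⟩
        exact Fin.one_le_of_ne_zero this

lemma IsMinimalRomanDominating.exists_isOpenIrredundant [Fintype V] {f : V → Fin 3}
    (h : IsMinimalRomanDominating G f) : ∃ D, IsOpenIrredundant G D ∧ rdfOf G D = f := by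
  have hlower : ∀ v k, k < f v → ¬ IsRomanDominating G (Function.update f v k) := by
    intro v k hk hr
    have := h.2 hr (update_le_iff.2 ⟨hk.le, fun _ _ => le_rfl⟩) v
    rw [Function.update_self] at this
    exact absurd hk this.not_gt
  refine ⟨univ.filter fun v => f v = 2, fun v hv => ?_, ?_⟩
  · simp only [mem_filter, mem_univ, true_and] at hv ⊢
    -- Without a private neighbour, `v` could be lowered from `2` to `1`: every vertex of value `0`
    -- that it dominates has another neighbour of value `2`.
    by_contra! hc
    refine hlower v 1 (by rw [hv]; decide) fun w hw => ?_
    have hwv : w ≠ v := by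
      rintro rfl
      simp at hw
    rw [Function.update_of_ne hwv] at hw
    obtain ⟨u, hwu, hu⟩ := h.1 w hw
    by_cases huv : u = v
    · subst huv
      obtain ⟨x, hx, hwx, hxu⟩ := hc w (by simp [hw]) hwu.symm
      exact ⟨x, hwx, by rwa [Function.update_of_ne hxu]⟩
    · exact ⟨u, hwu, by rwa [Function.update_of_ne huv]⟩
  · funext v
    by_cases h2 : f v = 2
    · rw [h2, rdfOf_eq_two]
      simp [h2]
    have hD : v ∉ univ.filter fun v => f v = 2 := by simp [h2]
    rw [rdfOf, if_neg hD]
    by_cases h0 : f v = 0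
    · obtain ⟨u, hvu, hu⟩ := h.1 v h0
      rw [if_pos ⟨u, by simp [hu], hvu⟩, h0]
    have h1 : f v = 1 := by omega
    -- A vertex of value `1` with a neighbour of value `2` could be lowered to `0`.
    rw [if_neg, h1]
    rintro ⟨u, hu, hvu⟩
    simp only [mem_filter, mem_univ, true_and] at hu
    refine hlower v 0 (by rw [h1]; decide) fun w hw => ?_
    by_cases hwv : w = v
    · subst hwv
      exact ⟨u, hvu, by rwa [Function.update_of_ne hvu.ne']⟩
    · rw [Function.update_of_ne hwv] at hw
      obtain ⟨x, hwx, hx⟩ := h.1 w hw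
      refine ⟨x, hwx, ?_⟩
      rw [Function.update_of_ne, hx]
      rintro rfl
      exact h2 hx

lemma isMinimalRomanDominating_iff [Fintype V] {f : V → Fin 3} :
    IsMinimalRomanDominating G f ↔ ∃ D, IsOpenIrredundant G D ∧ rdfOf G D = f := by
  refine ⟨fun h => h.exists_isOpenIrredundant, ?_⟩
  rintro ⟨D, hD, rfl⟩
  exact hD.isMinimalRomanDominating

variable (G) in
/-- A graph of order `n` has at most `1.9332 ^ n` minimal Roman dominating functions. -/
theorem ncard_isMinimalRomanDominating_le [Fintype V] :
    ({f : V → Fin 3 | IsMinimalRomanDominating G f}.ncard : ℝ) ≤ 1.9332 ^ Fintype.card V := by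
  refine le_trans ?_ (card_isOpenIrredundant_le G)
  rw [show {f : V → Fin 3 | IsMinimalRomanDominating G f} =
    rdfOf G '' ((univ.filter fun D => IsOpenIrredundant G D : Finset (Finset V)) : Set _) by
      ext f; simp [isMinimalRomanDominating_iff], Set.ncard_image_of_injective _ rdfOf_injective,
    Set.ncard_coe_finset]

/-! # Enumeration in lexicographic order -/

/-- The open irredundant sets, apart from `S`, that agree with `S` below `x` and are bounded
by `x + j`. -/
noncomputable def irredundantFrom (H : SimpleGraph ℕ) : ℕ → ℕ → Finset ℕ → List (Finset ℕ)
  | 0, _, _ => []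
  | j + 1, x, S => irredundantFrom H j (x + 1) S ++
      if IsOpenIrredundant H (insert x S) then
        insert x S :: irredundantFrom H j (x + 1) (insert x S) else []

variable {H : SimpleGraph ℕ}

lemma mem_irredundantFrom {j x : ℕ} {S S' : Finset ℕ} (hS : S ⊆ range x) :
    S' ∈ irredundantFrom H j x S ↔ IsOpenIrredundant H S' ∧ S' ≠ S ∧ S' ⊆ range (x + j) ∧
      S'.filter (· < x) = S := by
  induction j generalizing x S with
  | zero =>
    simp only [irredundantFrom, List.not_mem_nil, false_iff, add_zero]
    rintro ⟨-, h1, h2, h3⟩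
    refine h1 (h3 ▸ (filter_true_of_mem fun y hy => ?_).symm)
    exact mem_range.1 (h2 hy)
  | succ j ih =>
    have hxS : x ∉ S := fun h => by simpa using hS h
    have hS1 : S ⊆ range (x + 1) := hS.trans (range_mono (by omega))
    have hS2 : insert x S ⊆ range (x + 1) := insert_subset (by simp) hS1
    have e : x + 1 + j = x + (j + 1) := by omega
    have hfilter : S'.filter (· < x + 1) =
        if x ∈ S' then insert x (S'.filter (· < x)) else S'.filter (· < x) := by
      ext y
      split_ifs with h
      · simp only [mem_filter, mem_insert]
        constructor
        · rintro ⟨h1, h2⟩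
          rcases Nat.lt_succ_iff_lt_or_eq.1 h2 with h3 | h3
          exacts [.inr ⟨h1, h3⟩, .inl h3]
        · rintro (rfl | ⟨h1, h2⟩)
          exacts [⟨h, by omega⟩, ⟨h1, by omega⟩]
      · simp only [mem_filter]
        refine and_congr_right fun h1 => ⟨fun h2 => ?_, fun h2 => by omega⟩
        rcases Nat.lt_succ_iff_lt_or_eq.1 h2 with h3 | rfl
        exacts [h3, absurd h1 h]
    have hxf : x ∉ S'.filter (· < x) := by simp
    rw [irredundantFrom, List.mem_append, ih hS1, e]
    by_cases hx : x ∈ S'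
    · rw [if_pos hx] at hfilter
      have hne : S' ≠ S := fun h => hxS (h ▸ hx)
      have h1 : insert x (S'.filter (· < x)) ≠ S := fun h => hxS (h ▸ mem_insert_self _ _)
      have h2 : insert x (S'.filter (· < x)) = insert x S ↔ S'.filter (· < x) = S := by
        refine ⟨fun h => ?_, fun h => by rw [h]⟩
        rw [← erase_insert hxf, h, erase_insert hxS]
      rw [hfilter]
      by_cases hI : IsOpenIrredundant H (insert x S)
      · rw [if_pos hI, List.mem_cons, ih hS2, e, hfilter, h2]
        constructor
        · rintro (⟨-, -, -, h⟩ | rfl | ⟨h3, -, h4, h5⟩)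
          · exact absurd h h1
          · refine ⟨hI, hne, hS2.trans (range_mono (by omega)), ?_⟩
            rw [filter_insert, if_neg (by omega)]
            exact filter_true_of_mem fun y hy => mem_range.1 (hS hy)
          · exact ⟨h3, hne, h4, h5⟩
        · rintro ⟨h3, -, h4, h5⟩
          by_cases h6 : S' = insert x S
          exacts [.inr (.inl h6), .inr (.inr ⟨h3, h6, h4, h5⟩)]
      · rw [if_neg hI]
        simp only [List.not_mem_nil, or_false, h1, and_false, false_iff]
        rintro ⟨h3, -, -, rfl⟩
        -- By heredity, no open irredundant set extends a rejected `insert x S`.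
        exact hI (h3.subset (insert_subset hx (filter_subset _ _)))
    · rw [if_neg hx] at hfilter
      rw [hfilter]
      refine or_iff_left ?_
      split_ifs with hI
      · rw [List.mem_cons, ih hS2, hfilter]
        rintro (rfl | ⟨-, -, -, h⟩)
        · exact hx (mem_insert_self _ _)
        · exact hxf (h ▸ mem_insert_self _ _)
      · exact List.not_mem_nil

lemma nodup_irredundantFrom {j x : ℕ} {S : Finset ℕ} (hS : S ⊆ range x) :
    (irredundantFrom H j x S).Nodup := by
  induction j generalizing x S with
  | zero => exact List.nodup_nil
  | succ j ih =>
    have hxS : x ∉ S := fun h => by simpa using hS h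
    have hS1 : S ⊆ range (x + 1) := hS.trans (range_mono (by omega))
    have hS2 : insert x S ⊆ range (x + 1) := insert_subset (by simp) hS1
    rw [irredundantFrom]
    refine List.Nodup.append (ih hS1) ?_ ?_
    · split_ifs
      · refine List.nodup_cons.2 ⟨fun h => ?_, ih hS2⟩
        exact ((mem_irredundantFrom hS2).1 h).2.1 rfl
      · exact List.nodup_nil
    · intro S' h1 h2
      have h3 : x ∉ S' := fun h => by
        have := ((mem_irredundantFrom hS1).1 h1).2.2.2
        exact hxS (this ▸ mem_filter.2 ⟨h, by omega⟩)
      split_ifs at h2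
      · rcases List.mem_cons.1 h2 with rfl | h2
        · exact h3 (mem_insert_self _ _)
        · have := ((mem_irredundantFrom hS2).1 h2).2.2.2
          exact h3 (mem_of_mem_filter x (this ▸ mem_insert_self x S))
      · exact List.not_mem_nil h2

end MinimalRDF

/-! ### Memory counts and output words in terms of open irredundant sets -/

namespace RAM

open Classical Finset

variable {n : ℕ} {G : SimpleGraph (Fin n)}

/-- The graph is moved to `ℕ`, where addresses live; the added vertices are isolated. -/
lemma adjEntry_eq (a b : ℕ) :
    adjEntry G a b = if (G.map Fin.valEmbedding).Adj a b then 1 else 0 := by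
  unfold adjEntry
  congr 1
  rw [SimpleGraph.map_adj, eq_iff_iff]
  constructor
  · rintro ⟨ha, hb, h⟩
    exact ⟨_, _, h, rfl, rfl⟩
  · rintro ⟨u, v, h, rfl, rfl⟩
    exact ⟨u.2, v.2, h⟩

/-- The function with value `1` on `S` and `0` elsewhere. -/
noncomputable def markOf (S : Finset ℕ) (i : ℕ) : ℕ := if i ∈ S then 1 else 0

variable {S : Finset ℕ}

lemma neighborCount_markOf (hS : S ⊆ range n) (u : ℕ) :
    neighborCount G (markOf S) u = (S.filter ((G.map Fin.valEmbedding).Adj u)).card := by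
  unfold neighborCount
  rw [card_filter, ← sum_subset hS]
  · refine sum_congr rfl fun w hw => ?_
    rw [adjEntry_eq, markOf, if_pos hw]
    split_ifs <;> rfl
  · intro w _ hw
    rw [markOf, if_neg hw, Nat.zero_sub]

lemma badCount_markOf (hS : S ⊆ range n) :
    badCount G (markOf S) = 0 ↔ IsOpenIrredundant (G.map Fin.valEmbedding) S := by
  have hlt : ∀ {a b : ℕ}, (G.map Fin.valEmbedding).Adj a b → b < n := by
    rintro a b h
    obtain ⟨u, v, -, -, rfl⟩ := (SimpleGraph.map_adj _ _ _ _).1 h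
    exact v.2
  have hterm : ∀ v ∈ S, ∀ u, (1 - (neighborCount G (markOf S) u - 1) -
      (1 - neighborCount G (markOf S) u) - (1 - adjEntry G v u) - markOf S u ≠ 0 ↔
      u ∉ S ∧ (G.map Fin.valEmbedding).Adj v u ∧
        ∀ w ∈ S, (G.map Fin.valEmbedding).Adj u w → w = v) := by
    intro v hv u
    rw [neighborCount_markOf hS, adjEntry_eq, markOf]
    by_cases hu : u ∈ S
    · simp only [hu, if_true, not_true, false_and, iff_false]
      omega
    by_cases hvu : (G.map Fin.valEmbedding).Adj v u
    · simp only [hu, hvu, if_true, if_false, not_false_eq_true, true_and]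
      -- As `v` is itself a selected neighbour of `u`, uniqueness means that the count is exactly
      -- one.
      have hmem : v ∈ S.filter ((G.map Fin.valEmbedding).Adj u) := mem_filter.2 ⟨hv, hvu.symm⟩
      have hpos := card_pos.2 ⟨v, hmem⟩
      rw [show (∀ w ∈ S, (G.map Fin.valEmbedding).Adj u w → w = v) ↔
        (S.filter ((G.map Fin.valEmbedding).Adj u)).card ≤ 1 by
          rw [card_le_one_iff]
          constructor
          · intro h a b ha hb
            rw [mem_filter] at ha hb
            rw [h a ha.1 ha.2, h b hb.1 hb.2]
          · intro h w hw huw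
            exact h (mem_filter.2 ⟨hw, huw⟩) hmem]
      omega
    · simp only [hu, hvu, if_false, false_and, and_false, iff_false]
      omega
  unfold badCount
  rw [sum_eq_zero_iff]
  constructor
  · intro h v hv
    have h1 := h v (hS hv)
    rw [markOf, if_pos hv] at h1
    have h2 : privateCount G (markOf S) v ≠ 0 := by omega
    unfold privateCount at h2
    obtain ⟨u, -, hu⟩ := exists_ne_zero_of_sum_ne_zero h2
    exact ⟨u, (hterm v hv u).1 hu⟩
  · intro h v _
    by_cases hv : v ∈ S
    · obtain ⟨u, hu⟩ := h v hv
      have : privateCount G (markOf S) v ≠ 0 := fun h0 =>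
        (hterm v hv u).2 hu (sum_eq_zero_iff.1 h0 u (mem_range.2 (hlt hu.2.1)))
      rw [markOf, if_pos hv]
      omega
    · rw [markOf, if_neg hv, Nat.zero_sub]

lemma isOpenIrredundant_map_iff (D : Finset (Fin n)) :
    IsOpenIrredundant (G.map Fin.valEmbedding) (D.map Fin.valEmbedding) ↔
      IsOpenIrredundant G D := by
  constructor
  · intro h v hv
    obtain ⟨u, hu, hvu, hw⟩ := h v (mem_map_of_mem _ hv)
    obtain ⟨v', u, hvu', hv', rfl⟩ := (SimpleGraph.map_adj _ _ _ _).1 hvu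
    obtain rfl : v' = v := Fin.ext hv'
    refine ⟨u, fun h => hu (mem_map_of_mem _ h), hvu', fun w hwD huw => ?_⟩
    exact Fin.ext (hw w (mem_map_of_mem _ hwD) (SimpleGraph.map_adj_apply.2 huw))
  · intro h v hv
    obtain ⟨v, hvD, rfl⟩ := mem_map.1 hv
    obtain ⟨u, hu, hvu, hw⟩ := h v hvD
    refine ⟨Fin.valEmbedding u, ?_, SimpleGraph.map_adj_apply.2 hvu, fun w hwD huw => ?_⟩
    · rwa [mem_map']
    · obtain ⟨w, hwD', rfl⟩ := mem_map.1 hwD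
      exact congrArg _ (hw w hwD' (SimpleGraph.map_adj_apply.1 huw))

lemma exists_eq_map (hS : S ⊆ range n) : ∃ D : Finset (Fin n), D.map Fin.valEmbedding = S := by
  refine ⟨univ.filter fun i => (i : ℕ) ∈ S, ?_⟩
  ext i
  simp only [mem_map, mem_filter, mem_univ, true_and]
  constructor
  · rintro ⟨j, hj, rfl⟩
    exact hj
  · intro hi
    exact ⟨⟨i, mem_range.1 (hS hi)⟩, hi, rfl⟩

/-- Each member has a neighbour, which excludes the isolated vertices from `n` on. -/
lemma subset_range_of_isOpenIrredundant
    (h : IsOpenIrredundant (G.map Fin.valEmbedding) S) : S ⊆ range n := by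
  intro v hv
  obtain ⟨u, -, hvu, -⟩ := h v hv
  obtain ⟨v, -, -, rfl, -⟩ := (SimpleGraph.map_adj _ _ _ _).1 hvu
  exact mem_range.2 v.2

lemma map_outputValue (D : Finset (Fin n)) :
    (List.range n).map (outputValue G (markOf (D.map Fin.valEmbedding))) =
      valueWord (rdfOf G D) := by
  have hS : D.map Fin.valEmbedding ⊆ range n := by
    intro i hi
    obtain ⟨j, -, rfl⟩ := mem_map.1 hi
    exact mem_range.2 j.2
  refine List.ext_getElem (by simp [valueWord]) fun i h1 h2 => ?_
  have hi : i < n := by simpa using h1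
  have hmem : i ∈ D.map Fin.valEmbedding ↔ (⟨i, hi⟩ : Fin n) ∈ D := by
    refine ⟨fun h => ?_, fun h => mem_map_of_mem Fin.valEmbedding h⟩
    obtain ⟨j, hj, rfl⟩ := mem_map.1 h
    exact hj
  simp only [valueWord, List.getElem_map, List.getElem_range, List.getElem_ofFn, outputValue,
    neighborCount_markOf hS, rdfOf, markOf, hmem]
  by_cases hD : (⟨i, hi⟩ : Fin n) ∈ D
  · simp only [hD, if_true]
    simp
  · simp only [hD, if_false, Nat.add_zero, Nat.sub_zero, Nat.zero_add]
    by_cases hn : HasNeighborIn G D ⟨i, hi⟩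
    · obtain ⟨j, hj, hij⟩ := id hn
      have : 0 < ((D.map Fin.valEmbedding).filter ((G.map Fin.valEmbedding).Adj i)).card :=
        card_pos.2 ⟨j, mem_filter.2 ⟨mem_map_of_mem Fin.valEmbedding hj,
          SimpleGraph.map_adj_apply.2 hij⟩⟩
      rw [if_pos hn]
      exact Nat.sub_eq_zero_of_le this
    · rw [if_neg hn, card_eq_zero.2]
      · rfl
      · refine filter_eq_empty_iff.2 fun w hw hiw => hn ?_
        obtain ⟨j, hj, rfl⟩ := mem_map.1 hw
        exact ⟨j, hj, SimpleGraph.map_adj_apply.1 hiw⟩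

variable (G) in
/-- All open irredundant sets. -/
noncomputable def allIrredundant : List (Finset ℕ) :=
  ∅ :: irredundantFrom (G.map Fin.valEmbedding) n 0 ∅

lemma mem_allIrredundant :
    S ∈ allIrredundant G ↔ IsOpenIrredundant (G.map Fin.valEmbedding) S := by
  rw [allIrredundant, List.mem_cons, mem_irredundantFrom (empty_subset _)]
  constructor
  · rintro (rfl | h)
    · exact fun v hv => absurd hv (notMem_empty v)
    · exact h.1
  · intro h
    by_cases h0 : S = ∅
    · exact .inl h0
    · exact .inr ⟨h, h0, by simpa using subset_range_of_isOpenIrredundant h, by simp⟩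

lemma nodup_allIrredundant : (allIrredundant G).Nodup :=
  List.nodup_cons.2 ⟨fun h => ((mem_irredundantFrom (empty_subset _)).1 h).2.1 rfl,
    nodup_irredundantFrom (empty_subset _)⟩

lemma mem_allIrredundant_iff_exists_map :
    S ∈ allIrredundant G ↔ ∃ D, IsOpenIrredundant G D ∧ D.map Fin.valEmbedding = S := by
  rw [mem_allIrredundant]
  constructor
  · intro h
    obtain ⟨D, rfl⟩ := exists_eq_map (subset_range_of_isOpenIrredundant h)
    exact ⟨D, (isOpenIrredundant_map_iff D).1 h, rfl⟩
  · rintro ⟨D, hD, rfl⟩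
    exact (isOpenIrredundant_map_iff D).2 hD

lemma length_allIrredundant_le : ((allIrredundant G).length : ℝ) ≤ 1.9332 ^ n := by
  have h := card_isOpenIrredundant_le G
  rw [Fintype.card_fin] at h
  refine le_trans ?_ h
  rw [← List.toFinset_card_of_nodup nodup_allIrredundant,
    show (allIrredundant G).toFinset = (univ.filter fun D => IsOpenIrredundant G D).image
      (fun D => D.map Fin.valEmbedding) by
        ext S
        simp [mem_allIrredundant_iff_exists_map]]
  exact_mod_cast card_image_le

/-- The words of all open irredundant sets are those of the minimal Roman dominating functions. -/
lemma mem_words_iff {w : List ℕ} :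
    w ∈ (allIrredundant G).map (fun S => (List.range n).map (outputValue G (markOf S))) ↔
      ∃ f : Fin n → Fin 3, IsMinimalRomanDominating G f ∧ w = valueWord f := by
  simp only [List.mem_map, mem_allIrredundant_iff_exists_map, isMinimalRomanDominating_iff]
  constructor
  · rintro ⟨_, ⟨D, hD, rfl⟩, rfl⟩
    exact ⟨_, ⟨D, hD, rfl⟩, map_outputValue D⟩
  · rintro ⟨_, ⟨D, hD, rfl⟩, rfl⟩
    exact ⟨_, ⟨D, hD, rfl⟩, map_outputValue D⟩

lemma nodup_words :
    ((allIrredundant G).map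
      (fun S => (List.range n).map (outputValue G (markOf S)))).Nodup := by
  refine List.Nodup.map_on (fun S hS S' hS' h => ?_) nodup_allIrredundant
  rw [mem_allIrredundant_iff_exists_map] at hS hS'
  obtain ⟨D, -, rfl⟩ := hS
  obtain ⟨D', -, rfl⟩ := hS'
  rw [map_outputValue, map_outputValue] at h
  have : rdfOf G D = rdfOf G D' := funext fun i => Fin.ext (congrFun (List.ofFn_injective h) i)
  rw [rdfOf_injective this]

end RAM

/-! ### Correctness and delay of the search -/

namespace RAM

open Finset

variable {n : ℕ} {G : SimpleGraph (Fin n)} {B d : ℕ} {M : ℕ →₀ ℕ} {w : List ℕ}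

lemma marks_update_of_lt {a v : ℕ} (ha : a < 7) : marks (M.update a v) = marks M := by
  funext i
  simp only [marks, update_apply_eq]
  rw [if_neg (by omega)]

lemma marks_update_eq (x v : ℕ) :
    marks (M.update (7 + x) v) = Function.update (marks M) x v := by
  funext i
  simp only [marks, update_apply_eq, Function.update_apply, Nat.add_left_cancel_iff]

lemma markOf_insert (S : Finset ℕ) (x : ℕ) :
    markOf (insert x S) = Function.update (markOf S) x 1 := by
  funext i
  simp only [markOf, Function.update_apply, mem_insert]
  split_ifs <;> tauto

lemma markOf_erase (S : Finset ℕ) (x : ℕ) :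
    markOf (S.erase x) = Function.update (markOf S) x 0 := by
  funext i
  simp only [markOf, Function.update_apply, mem_erase]
  split_ifs <;> tauto

lemma markOf_le_one (S : Finset ℕ) (i : ℕ) : markOf S i ≤ 1 := by
  unfold markOf
  split_ifs <;> omega

variable (n) in
/-- The number of steps of `countBad`. -/
def countBadTime : ℕ := n * (n * (n * 6 + 5 + 5) + 5 + 5) + 5

variable (n) in
/-- The number of steps of `printWord`. -/
def printWordTime : ℕ := n * (n * 6 + 5 + 4 + 1) + 3

variable (n) in
/-- A bound for the number of steps of a move of the search that does not find a set. -/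
def moveTime : ℕ := countBadTime n + 10

variable (n) in
/-- A bound for the number of steps between two outputs. -/
def delayBound : ℕ := (n + 1) * moveTime n + printWordTime n + 4

/-- The step counter ends at `1` because one store follows the output. -/
lemma report_seg (hB : n + 7 ≤ B) (hM : MemBounded B M) {S : Finset ℕ} (hS : marks M = markOf S)
    (l : List Program) {k : ℕ} (hk : k + printWordTime n + 3 ≤ d) :
    ∃ M', Seg G B d ⟨report :: l, M, []⟩ ⟨l, M', []⟩ k 1
      [(List.range n).map (outputValue G (markOf S))] ∧ M' 0 = n ∧ marks M' = markOf S ∧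
      MemBounded B M' := by
  obtain ⟨M₁, w, k₁, h1, h2, ⟨rfl, h3, h4⟩, h5⟩ := printWord_runs (G := G) (d := d) hB
    (fun i _ => hS ▸ markOf_le_one S i) hM
    (.seq .emit (.store (.const 0) .order) :: l) (k + 1) (by unfold printWordTime at hk; omega)
  have h6 : MemBounded B (M₁.update 0 n) := h2.update (by omega) (by omega)
  have hk₁ : k₁ + 2 ≤ d := by unfold printWordTime at hk; omega
  rw [hS] at h5 h4
  refine ⟨M₁.update 0 n, .silent hM (by omega) rfl (h5.trans (.silent h2 (by omega) rfl
    (.emit h2 (by omega) rfl (.silent h2 (by omega) rfl (.refl h6 (by omega)))))), ?_, ?_, h6⟩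
  · simp [update_apply_eq]
  · rw [marks_update_of_lt (by omega), h4]

lemma searchStep_selected (hB : n + 7 ≤ B) (hM : MemBounded B M) {S : Finset ℕ}
    (hS : marks M = markOf S) {x : ℕ} (hx : M 0 = x + 1) (hxS : x ∈ S) (hxn : x < n)
    (l : List Program) {k : ℕ} (hk : k + 4 ≤ d) :
    ∃ M', Seg G B d ⟨searchStep :: l, M, w⟩ ⟨l, M', w⟩ k (k + 4) [] ∧ M' 0 = x ∧
      marks M' = markOf (S.erase x) ∧ MemBounded B M' := by
  have h1 : MemBounded B (M.update 0 x) := hM.update (by omega) (by omega)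
  have h2 : MemBounded B ((M.update 0 x).update (7 + x) 0) := h1.update (by omega) (by omega)
  have hm : marks (M.update 0 x) = markOf S := by rw [marks_update_of_lt (by omega), hS]
  have h0 : (M.update 0 x) 0 = x := by simp [update_apply_eq]
  have e1 : step G ⟨.store (.const 0) (.sub (reg 0) (.const 1)) ::
      .cond (selected 0) (select 0) (.seq (select 1) (.seq countBad
        (.cond (reg 6) (select 0) report))) :: l, M, w⟩ =
      ⟨.cond (selected 0) (select 0) (.seq (select 1) (.seq countBad
        (.cond (reg 6) (select 0) report))) :: l, M.update 0 x, w⟩ := by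
    simp [step, Expr.eval, eval_reg, hx]
  have hne : (selected 0).eval G (M.update 0 x) ≠ 0 := by
    rw [eval_selected, h0]
    change marks _ x ≠ 0
    rw [hm, markOf, if_pos hxS]
    exact one_ne_zero
  refine ⟨(M.update 0 x).update (7 + x) 0, .silent hM (by omega) rfl
    (.next hM (by omega) rfl e1 ?_), ?_, ?_, h2⟩
  · refine .silent h1 (by omega) rfl ?_
    rw [step, if_pos hne]
    refine .silent h1 (by omega) rfl ?_
    rw [select, step]
    simp only [Expr.eval, eval_reg, h0]
    exact .refl h2 (by omega)
  · rw [update_apply_eq, if_neg (by omega), h0]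
  · rw [marks_update_eq, hm, markOf_erase]

lemma searchStep_test (hB : n + 7 ≤ B) (hM : MemBounded B M) {S : Finset ℕ}
    (hS : marks M = markOf S) {x : ℕ} (hx : M 0 = x + 1) (hxS : x ∉ S) (hxn : x < n)
    (l : List Program) {k : ℕ} (hk : k + countBadTime n + 6 ≤ d) :
    ∃ M' k', Seg G B d ⟨searchStep :: l, M, w⟩ ⟨.cond (reg 6) (select 0) report :: l, M', w⟩
      k k' [] ∧ M' 0 = x ∧ M' 6 = badCount G (markOf (insert x S)) ∧
      marks M' = markOf (insert x S) ∧ MemBounded B M' ∧ k' ≤ k + countBadTime n + 6 := by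
  have h1 : MemBounded B (M.update 0 x) := hM.update (by omega) (by omega)
  have h2 : MemBounded B ((M.update 0 x).update (7 + x) 1) := h1.update (by omega) (by omega)
  have hm : marks (M.update 0 x) = markOf S := by rw [marks_update_of_lt (by omega), hS]
  have h0 : (M.update 0 x) 0 = x := by simp [update_apply_eq]
  have hm2 : marks ((M.update 0 x).update (7 + x) 1) = markOf (insert x S) := by
    rw [marks_update_eq, hm, markOf_insert]
  have e1 : step G ⟨.store (.const 0) (.sub (reg 0) (.const 1)) ::
      .cond (selected 0) (select 0) (.seq (select 1) (.seq countBad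
        (.cond (reg 6) (select 0) report))) :: l, M, w⟩ =
      ⟨.cond (selected 0) (select 0) (.seq (select 1) (.seq countBad
        (.cond (reg 6) (select 0) report))) :: l, M.update 0 x, w⟩ := by
    simp [step, Expr.eval, eval_reg, hx]
  have hne : ¬ (selected 0).eval G (M.update 0 x) ≠ 0 := by
    rw [eval_selected, h0, not_not]
    change marks _ x = 0
    rw [hm, markOf, if_neg hxS]
  obtain ⟨M₁, w', k₁, h3, h4, ⟨rfl, h5, h6, h7⟩, h8⟩ := countBad_runs (G := G) (d := d) (w := w) hB
    (fun i _ => hm2 ▸ markOf_le_one (insert x S) i) h2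
    (.cond (reg 6) (select 0) report :: l) (k + 6) (by unfold countBadTime at hk; omega)
  rw [hm2] at h5 h7
  refine ⟨M₁, k₁, .silent hM (by omega) rfl (.next hM (by omega) rfl e1 ?_), ?_, h5, h7, h4, ?_⟩
  · refine .silent h1 (by omega) rfl ?_
    rw [step, if_neg hne]
    refine .silent h1 (by omega) rfl (.silent h1 (by omega) rfl ?_)
    rw [step, select, step]
    simp only [Expr.eval, eval_reg, h0]
    exact .silent h2 (by omega) rfl h8
  · rw [h6, update_apply_eq, if_neg (by omega), h0]
  · unfold countBadTime
    omega

/-- The search from a selected set `S` below `x` finds all sets that agree with `S` below `x`. -/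
lemma search_seg (hB : n + 7 ≤ B) (l : List Program) {j x : ℕ} (hj : x + j = n) {S : Finset ℕ}
    (hSx : S ⊆ range x) {M : ℕ →₀ ℕ} (hM : MemBounded B M) (h0 : M 0 = n)
    (hS : marks M = markOf S) :
    ∃ M' k', Seg G B (delayBound n) ⟨.loop (reg 0) searchStep :: l, M, []⟩
      ⟨.loop (reg 0) searchStep :: l, M', []⟩ 1 k'
      ((irredundantFrom (G.map Fin.valEmbedding) j x S).map
        fun S => (List.range n).map (outputValue G (markOf S))) ∧ M' 0 = x ∧
      marks M' = markOf S ∧ MemBounded B M' ∧ k' ≤ 1 + j * moveTime n := by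
  -- After the last output the position descends from `n` to `x` with at most one move per vertex,
  -- which explains the bound on `k'`.
  induction j generalizing x S M with
  | zero =>
    refine ⟨M, 1, .refl hM ?_, by omega, hS, hM, by omega⟩
    unfold delayBound
    omega
  | succ j ih =>
    have hxS : x ∉ S := fun h => by simpa using hSx h
    have hS1 : S ⊆ range (x + 1) := hSx.trans (range_mono (by omega))
    have hS2 : insert x S ⊆ range (x + 1) := insert_subset (by simp) hS1
    have hjn : (j + 1) * moveTime n ≤ n * moveTime n := Nat.mul_le_mul_right _ (by omega)
    have hd : delayBound n = n * moveTime n + countBadTime n + printWordTime n + 14 := by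
      unfold delayBound moveTime
      ring
    have hmove : moveTime n = countBadTime n + 10 := rfl
    rw [Nat.succ_mul] at hjn ⊢
    have enter : ∀ {M : ℕ →₀ ℕ}, M 0 = x + 1 → step G ⟨.loop (reg 0) searchStep :: l, M, []⟩ =
        ⟨searchStep :: .loop (reg 0) searchStep :: l, M, []⟩ := fun {M} h => by
      simp [step, eval_reg, h]
    obtain ⟨M₁, k₁, s₁, h01, hm₁, hM₁, hk₁⟩ := ih (by omega) hS1 hM h0 hS
    obtain ⟨M₂, k₂, s₂, h02, h62, hm₂, hM₂, hk₂⟩ := searchStep_test (G := G) (d := delayBound n)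
      (w := []) hB hM₁ hm₁ h01 hxS (by omega) (.loop (reg 0) searchStep :: l) (k := k₁ + 1)
      (by omega)
    have s₁₂ := s₁.trans (.next hM₁ (by omega) rfl (enter h01) s₂)
    have hbad := badCount_markOf (G := G) (S := insert x S)
      (hS2.trans (range_mono (by omega)))
    rw [← h62] at hbad
    rw [irredundantFrom, List.map_append]
    by_cases hI : IsOpenIrredundant (G.map Fin.valEmbedding) (insert x S)
    · rw [if_pos hI, List.map_cons]
      have e : step G ⟨.cond (reg 6) (select 0) report :: .loop (reg 0) searchStep :: l, M₂, []⟩ =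
          ⟨report :: .loop (reg 0) searchStep :: l, M₂, []⟩ := by
        simp [step, eval_reg, hbad.2 hI]
      -- After the output the position is `n` again. The search below `insert x S` brings it back to
      -- `x + 1`, and the next move removes `x`, restoring `S`.
      obtain ⟨M₃, s₃, h03, hm₃, hM₃⟩ := report_seg (G := G) (d := delayBound n) hB hM₂ hm₂
        (.loop (reg 0) searchStep :: l) (k := k₂ + 1) (by omega)
      obtain ⟨M₄, k₄, s₄, h04, hm₄, hM₄, hk₄⟩ := ih (by omega) hS2 hM₃ h03 hm₃
      obtain ⟨M₅, s₅, h05, hm₅, hM₅⟩ := searchStep_selected (G := G) (d := delayBound n)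
        (w := []) hB hM₄ hm₄ h04 (mem_insert_self x S) (by omega)
        (.loop (reg 0) searchStep :: l) (k := k₄ + 1) (by omega)
      refine ⟨M₅, k₄ + 1 + 4, ?_, h05, by rw [hm₅, erase_insert hxS], hM₅, by omega⟩
      have := s₁₂.trans (.next hM₂ (by omega) rfl e
        (s₃.trans (s₄.trans (.next hM₄ (by omega) rfl (enter h04) s₅))))
      simpa using this
    · rw [if_neg hI]
      have hne : M₂ 6 ≠ 0 := fun h => hI (hbad.1 h)
      have e : step G ⟨.cond (reg 6) (select 0) report :: .loop (reg 0) searchStep :: l, M₂, []⟩ =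
          ⟨select 0 :: .loop (reg 0) searchStep :: l, M₂, []⟩ := by
        simp [step, eval_reg, hne]
      have e' : step G ⟨select 0 :: .loop (reg 0) searchStep :: l, M₂, []⟩ =
          ⟨.loop (reg 0) searchStep :: l, M₂.update (7 + x) 0, []⟩ := by
        simp [step, select, Expr.eval, eval_reg, h02]
      have hM₃ : MemBounded B (M₂.update (7 + x) 0) := hM₂.update (by omega) (by omega)
      refine ⟨M₂.update (7 + x) 0, k₂ + 1 + 1, ?_, ?_, ?_, hM₃, by omega⟩
      · have s₃ : Seg G B (delayBound n) _ _ k₂ (k₂ + 1 + 1) [] :=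
          .next hM₂ (by omega) rfl e (.next hM₂ (by omega) rfl e' (.refl hM₃ (by omega)))
        simpa using s₁₂.trans s₃
      · rw [update_apply_eq, if_neg (by omega), h02]
      · rw [marks_update_eq, hm₂, ← markOf_erase, erase_insert hxS]

-- The empty set is reported before the loop, since `irredundantFrom` omits its starting set. The
-- loop ends when the position is `0`.
variable (G) in
lemma enumerate_seg :
    ∃ M k, Seg G (n + 7) (delayBound n) ⟨[enumerate], 0, []⟩ ⟨[], M, []⟩ 0 k
      ((allIrredundant G).map fun S => (List.range n).map (outputValue G (markOf S))) := by
  have hd : delayBound n = n * moveTime n + countBadTime n + printWordTime n + 14 := by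
    unfold delayBound moveTime
    ring
  have hM : MemBounded (n + 7) 0 := ⟨fun a => by simp, fun a _ => by simp⟩
  have hm : marks 0 = markOf ∅ := by
    funext i
    simp [marks, markOf]
  obtain ⟨M₁, s₁, h1, hm₁, hM₁⟩ := report_seg (G := G) (d := delayBound n) le_rfl hM hm
    [.loop (reg 0) searchStep] (k := 1) (by omega)
  obtain ⟨M₂, k₂, s₂, h2, -, hM₂, hk₂⟩ := search_seg (G := G) le_rfl [] (zero_add n)
    (empty_subset _) hM₁ h1 hm₁
  have e : step G ⟨[.loop (reg 0) searchStep], M₂, []⟩ = ⟨[], M₂, []⟩ := by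
    simp [step, eval_reg, h2]
  have s₃ : Seg G (n + 7) (delayBound n) ⟨[.loop (reg 0) searchStep], M₂, []⟩ ⟨[], M₂, []⟩
      k₂ (k₂ + 1) [] := .next hM₂ (by omega) rfl e (.refl hM₂ (by omega))
  refine ⟨M₂, k₂ + 1, .next (c₁ := ⟨[report, .loop (reg 0) searchStep], 0, []⟩) hM (by omega) rfl
    rfl ?_⟩
  simpa [allIrredundant] using s₁.trans (s₂.trans s₃)

end RAM

theorem mainTheorem1 :
    (∃ P : RAM.Program, ∃ delay space factor : Polynomial ℕ,
      ∀ (n : ℕ) (G : SimpleGraph (Fin n)), ∃ T : ℕ,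
        (P.run G T).Halted ∧
        EnumeratesMinimalRDF P G T ∧
        HasDelayAtMost P G T (delay.eval n) ∧
        (∀ t ≤ T, (P.run G t).space ≤ space.eval n) ∧
        (T : ℝ) ≤ ((factor.eval n : ℕ) : ℝ) * (1.9332 : ℝ) ^ n) ∧
    (∃ factor : Polynomial ℕ, ∀ (n : ℕ) (G : SimpleGraph (Fin n)),
      ({f : Fin n → Fin 3 | IsMinimalRomanDominating G f}.ncard : ℝ) ≤
        ((factor.eval n : ℕ) : ℝ) * (1.9332 : ℝ) ^ n) := by
  refine ⟨?_, 1, fun n G => ?_⟩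
  · obtain ⟨delay, hdelay⟩ : ∃ p : Polynomial ℕ, ∀ n, p.eval n = RAM.delayBound n := by
      open Polynomial in
      refine ⟨(X + 1) * (X * (X * (X * 6 + 5 + 5) + 5 + 5) + 5 + 10) +
        (X * (X * 6 + 5 + 4 + 1) + 3) + 4, fun n => ?_⟩
      simp [RAM.delayBound, RAM.moveTime, RAM.countBadTime, RAM.printWordTime]
    -- The space bound is `MemBounded.space_le` for `B = n + 7`. The factor `2 * delay` absorbs the
    -- extra gap, as `1.9332 ^ n + 1 ≤ 2 * 1.9332 ^ n`.
    refine ⟨RAM.enumerate, delay, (.X + 8) * (2 * (.X + 8)), 2 * delay, fun n G => ?_⟩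
    obtain ⟨M, k, hseg⟩ := RAM.enumerate_seg G
    obtain ⟨T, hT, hos, hmem, hchain⟩ := hseg.exists_time
    have hout : RAM.enumerate.outputs G T = RAM.outputsFrom G ⟨[RAM.enumerate], 0, []⟩ T := rfl
    have hdel : HasDelayAtMost RAM.enumerate G T (RAM.delayBound n) := by
      have := hchain 0 le_rfl
      simp only [Nat.sub_zero, Nat.zero_add] at this
      exact this
    refine ⟨T, ?_, ⟨?_, fun w => ?_⟩, ?_, fun t ht => ?_, ?_⟩
    · unfold RAM.Program.run
      rw [hT]
      rfl
    · rw [hout, hos]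
      exact RAM.nodup_words
    · rw [hout, hos]
      exact RAM.mem_words_iff
    · rw [hdelay]
      exact hdel
    · have h : (RAM.enumerate.run G t).space ≤ (n + 8) * (2 * (n + 8)) := (hmem t ht).space_le
      simpa using h
    · have h1 := RAM.le_of_isChain_delay hdel
      have h2 : ((RAM.enumerate.outputs G T).map Prod.fst).length =
          (RAM.allIrredundant G).length := by
        rw [List.length_map, hout, ← List.length_map (f := Prod.snd), hos, List.length_map]
      rw [h2, zero_add] at h1
      have h3 := RAM.length_allIrredundant_le (G := G)
      have h4 : (1 : ℝ) ≤ 1.9332 ^ n := one_le_pow₀ (by norm_num)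
      have h5 : (T : ℝ) ≤ ((RAM.allIrredundant G).length + 1) * RAM.delayBound n := by
        exact_mod_cast h1
      refine h5.trans ?_
      have h6 : ((RAM.allIrredundant G).length + 1 : ℝ) ≤ 2 * 1.9332 ^ n := by linarith
      refine (mul_le_mul_of_nonneg_right h6 (Nat.cast_nonneg _)).trans_eq ?_
      rw [Polynomial.eval_mul, hdelay]
      simp
      ring
  · simpa using ncard_isMinimalRomanDominating_le G
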